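/- Let $\rho>0$. There is a constant $C_\rho>0$, depending only on $\rho$, such that the following holds. Let $n\ge 1$, let $\mathcal F_0\subseteq\mathcal F_1\subseteq\dots\subseteq\mathcal F_n$ be a filtration on a probability space, and let $\xi_1,\dots,\xi_n$ be real martingale differences: each $\xi_i$ is $\mathcal F_i$-measurable and integrable with $\mathbf E[\xi_i\mid\mathcal F_{i-1}]=0$ a.s. Put $X_n=\sum_{i=1}^n\xi_i$ and $\langle X\rangle_n=\sum_{i=1}^n\mathbf E[\xi_i^2\mid\mathcal F_{i-1}]$, where conditional expectations of nonnegative variables may take the value $+\infty$. Assume: (A1) there is a number $\varepsilon_n\in(0,\tfrac12]$ with $\mathbf E[|\xi_i|^{2+\rho}\mid\mathcal F_{i-1}]\le\varepsilon_n^{\rho}\,\mathbf E[\xi_i^2\mid\mathcal F_{i-1}]$ a.s. for all $i=1,\dots,n$; (A2) there is a number $\delta_n\in[0,\tfrac12]$ with $\|\langle X\rangle_n-1\|_\infty\le\delta_n^2$. Then $$\|F_{X_n}-\Phi\|_1:=\int_{-\infty}^{\infty}|F_{X_n}(x)-\Phi(x)|\,dx\le C_\rho\,(\hat\varepsilon_n+\delta_n),$$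 where $F_{X_n}$ and $\Phi$ are the distribution functions of $X_n$ and of the standard normal law, and $\hat\varepsilon_n=\varepsilon_n^{\rho}$ if $\rho\in(0,1)$, $\hat\varepsilon_n=\varepsilon_n|\log\varepsilon_n|$ if $\rho\ge1$. -/

import Mathlib

open MeasureTheory ProbabilityTheory
open scoped ENNReal

namespace MartingaleCLT

/-- `ξ 1, …, ξ n` are martingale differences for the filtration `ℱ 0 ⊆ ℱ 1 ⊆ …`: each `ξ i` is
`ℱ i`-measurable and integrable, and `E[ξ i | ℱ (i - 1)] = 0` almost surely. -/
structure IsMartingaleDifference {Ω : Type*} {m0 : MeasurableSpace Ω} (μ : Measure Ω)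
    (ℱ : Filtration ℕ m0) (ξ : ℕ → Ω → ℝ) (n : ℕ) : Prop where
  measurable : ∀ i ∈ Finset.Icc 1 n, Measurable[ℱ i] (ξ i)
  integrable : ∀ i ∈ Finset.Icc 1 n, Integrable (ξ i) μ
  condExp_eq_zero : ∀ i ∈ Finset.Icc 1 n, μ[ξ i | ℱ (i - 1)] =ᵐ[μ] 0

/-- The conditional absolute moment `E[|Y| ^ r | m]`. The integrand is nonnegative, so this is
the `[0, ∞]`-valued conditional expectation, which exists without any integrability assumption. -/
noncomputable def condMoment {Ω : Type*} {m0 : MeasurableSpace Ω} (μ : Measure Ω)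
    (m : MeasurableSpace Ω) (r : ℝ) (Y : Ω → ℝ) : Ω → ℝ≥0∞ :=
  μ⁻[fun ω => ENNReal.ofReal (|Y ω| ^ r) | m]

/-- The conditional variance `⟨X⟩_n = ∑_{i=1}^n E[ξ_i² | ℱ_{i-1}]`. -/
noncomputable def condVariance {Ω : Type*} {m0 : MeasurableSpace Ω} (μ : Measure Ω)
    (ℱ : Filtration ℕ m0) (ξ : ℕ → Ω → ℝ) (n : ℕ) : Ω → ℝ≥0∞ :=
  fun ω => ∑ i ∈ Finset.Icc 1 n, condMoment μ (ℱ (i - 1)) 2 (ξ i) ω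

/-- The essential supremum `‖V - W‖_∞` for `[0, ∞]`-valued `V`, `W`. Subtraction is truncated at
`0`, so the sum of the two differences is the absolute value of the difference. -/
noncomputable def essDist {Ω : Type*} {m0 : MeasurableSpace Ω} (μ : Measure Ω)
    (V W : Ω → ℝ≥0∞) : ℝ≥0∞ :=
  essSup (fun ω => (V ω - W ω) + (W ω - V ω)) μ

/-- Conditional Lyapunov-type condition:
`E[|ξ_i|^(2+ρ) | ℱ_{i-1}] ≤ ε^ρ E[ξ_i² | ℱ_{i-1}]` a.s. for `i = 1, …, n`. -/
def CondLyapunov {Ω : Type*} {m0 : MeasurableSpace Ω} (μ : Measure Ω)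
    (ℱ : Filtration ℕ m0) (ξ : ℕ → Ω → ℝ) (n : ℕ) (ρ ε : ℝ) : Prop :=
  ∀ i ∈ Finset.Icc 1 n, ∀ᵐ ω ∂μ,
    condMoment μ (ℱ (i - 1)) (2 + ρ) (ξ i) ω
      ≤ ENNReal.ofReal (ε ^ ρ) * condMoment μ (ℱ (i - 1)) 2 (ξ i) ω

/-- `‖F_X - Φ‖_1 = ∫ |F_X(x) - Φ(x)| dx` as an element of `[0, ∞]`, where `F_X` is the
distribution function of `X` and `Φ` that of the standard normal law. -/
noncomputable def wassersteinNormal {Ω : Type*} {m0 : MeasurableSpace Ω} (μ : Measure Ω)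
    (X : Ω → ℝ) : ℝ≥0∞ :=
  ∫⁻ x : ℝ, ENNReal.ofReal |cdf (μ.map X) x - cdf (gaussianReal 0 1) x|

/-- The rate `ε̂`: `ε^ρ` if `ρ < 1`, and `ε |log ε|` if `ρ ≥ 1`. -/
noncomputable def epsHat (ρ ε : ℝ) : ℝ :=
  if ρ < 1 then ε ^ ρ else ε * |Real.log ε|

end MartingaleCLT

/-!
The proof is Lindeberg's replacement argument with Gaussian smoothing.

By duality (`lintegral_cdf_sub_le`) it suffices to bound `E h (X_n) - E h (N)` for every
`1`-Lipschitz `h`, with `N` standard normal. Let `φ(t, x) = E h (x + √t N)` (`gaussSmooth`).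
A change of variables by the Gaussian density ratio gives, without any differentiability of `h`, the expansion
`φ(t, x + u) = φ(t, x) + u φ' + u² φ'' / 2 + O(|u| ^ (2 + ρ) t ^ (-(1 + ρ) / 2))` for `0 ≤ ρ ≤ 1`
(`abs_gaussSmooth_taylor`); averaging it over a Gaussian `u` gives the matching expansion in the
variance (`abs_gaussSmooth_add_variance`).

Let `T_k = ε² + (1 + δ² - ⟨X⟩_k)`, the variance not yet used after `k` steps, smoothed by `ε²`.
It is `ℱ_{k-1}`-measurable and `T_{k-1} = T_k + σ_k²`, with `σ_k²` the conditional variance of `ξ_k`.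
So comparing `φ(T_k, X_k)` with `φ(T_{k-1}, X_{k-1})` is exactly comparing `ξ_k` with a Gaussian
of the same conditional variance. The first two orders cancel in conditional expectation, and the
conditional Lyapunov condition bounds the rest by a multiple of `ε ^ ρ E[σ_k² T_k ^ (-(1 + ρ) / 2)]`
(`integral_gaussSmooth_replace_le`). That condition also forces `σ_k² ≤ ε² ≤ T_k`
(`condMoment_two_le`), so the sum over `k` is, path by path, a Riemann sum for
`∫_{ε²}^2 t ^ (-(1 + ρ) / 2) dt` (`sum_rpow_mul_le`): it is bounded for `ρ < 1` and of order
`|log ε|` for `ρ = 1`. Removing the smoothing at the end costs `√T_n ≤ ε + 2 δ`, and comparing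
`φ(T_0, 0)` with `E h (N)` costs at most `ε + δ`. The case `ρ > 1` reduces to `ρ = 1`
(`condMoment_three_le`).
-/

namespace MartingaleCLT

/-! ### Gaussian integrals of Lipschitz functions -/

lemma integrable_exp_abs_gaussian (c : ℝ) :
    Integrable (fun z : ℝ => Real.exp (c * |z|)) (gaussianReal 0 1) :=
  integrable_exp_mul_abs (X := fun z : ℝ => z) (integrable_exp_mul_gaussianReal c)
    (integrable_exp_mul_gaussianReal (-c))

lemma integrable_gaussian_of_le_exp {g : ℝ → ℝ} (hg : Measurable g) (C c : ℝ)
    (h : ∀ z, |g z| ≤ C * Real.exp (c * |z|)) : Integrable g (gaussianReal 0 1) :=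
  ((integrable_exp_abs_gaussian c).const_mul C).mono' hg.aestronglyMeasurable
    (Filter.Eventually.of_forall h)

lemma abs_integral_le_integral_of_abs_le {α : Type*} {m : MeasurableSpace α} {ν : Measure α}
    {g b : α → ℝ} (hb : Integrable b ν) (h : ∀ x, |g x| ≤ b x) :
    |∫ x, g x ∂ν| ≤ ∫ x, b x ∂ν :=
  norm_integral_le_of_norm_le (f := g) hb (Filter.Eventually.of_forall h)

lemma integrable_fun_sub {α : Type*} {m : MeasurableSpace α} {ν : Measure α} {f g : α → ℝ}
    (hf : Integrable f ν) (hg : Integrable g ν) : Integrable (fun x => f x - g x) ν :=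
  hf.sub hg

lemma abs_le_exp_abs (z : ℝ) : |z| ≤ Real.exp |z| := by
  linarith [Real.add_one_le_exp |z|]

lemma integrable_id_gaussian : Integrable (fun z : ℝ => z) (gaussianReal 0 1) :=
  (memLp_id_gaussianReal 1).integrable le_rfl

lemma integrable_abs_gaussian : Integrable (fun z : ℝ => |z|) (gaussianReal 0 1) :=
  integrable_gaussian_of_le_exp (by fun_prop) 1 1 (fun z => by simpa using abs_le_exp_abs z)

lemma integrable_sq_gaussian : Integrable (fun z : ℝ => z ^ 2) (gaussianReal 0 1) :=
  integrable_gaussian_of_le_exp (by fun_prop) 1 2 (fun z => by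
    rw [two_mul, Real.exp_add, one_mul, abs_pow, sq]
    gcongr <;> exact abs_le_exp_abs z)

lemma integrable_cube_gaussian : Integrable (fun z : ℝ => |z| ^ 3) (gaussianReal 0 1) :=
  integrable_gaussian_of_le_exp (by fun_prop) 1 3 (fun z => by
    rw [abs_pow, abs_abs, one_mul, show (3 : ℝ) * |z| = (3 : ℕ) * |z| by norm_num,
      Real.exp_nat_mul]
    gcongr; exact abs_le_exp_abs z)

lemma integral_sq_gaussian : ∫ z : ℝ, z ^ 2 ∂(gaussianReal 0 1) = 1 := by
  have h := variance_fun_id_gaussianReal (μ := 0) (v := 1)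
  rw [variance_eq_integral measurable_id'.aemeasurable] at h
  simpa using h

lemma integral_sq_sub_one_gaussian : ∫ z : ℝ, (z ^ 2 - 1) ∂(gaussianReal 0 1) = 0 := by
  rw [integral_sub integrable_sq_gaussian (integrable_const 1), integral_sq_gaussian]
  simp

lemma integral_abs_gaussian_le : ∫ z : ℝ, |z| ∂(gaussianReal 0 1) ≤ 1 := by
  have h : ∫ z : ℝ, |z| ∂(gaussianReal 0 1) ≤ ∫ z : ℝ, (z ^ 2 + 1) / 2 ∂(gaussianReal 0 1) :=
    integral_mono integrable_abs_gaussian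
      ((integrable_sq_gaussian.add (integrable_const 1)).div_const 2)
      (fun z => by
        have := sq_nonneg (|z| - 1)
        have h2 := sq_abs z
        simp only
        nlinarith)
  refine h.trans (le_of_eq ?_)
  rw [integral_div, integral_add integrable_sq_gaussian (integrable_const 1), integral_sq_gaussian]
  simp

/-- Shifting the standard Gaussian by `u` multiplies its density by `exp (u z - u ^ 2 / 2)`. -/
lemma integral_gaussian_shift (F : ℝ → ℝ) (u : ℝ) :
    ∫ z, F (u + z) ∂(gaussianReal 0 1)
      = ∫ z, Real.exp (u * z - u ^ 2 / 2) * F z ∂(gaussianReal 0 1) := by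
  rw [integral_gaussianReal_eq_integral_smul one_ne_zero,
    integral_gaussianReal_eq_integral_smul one_ne_zero,
    ← integral_add_left_eq_self (fun z => gaussianPDFReal 0 1 z •
      (Real.exp (u * z - u ^ 2 / 2) * F z)) u]
  congr 1 with z
  simp only [gaussianPDFReal, smul_eq_mul, NNReal.coe_one]
  rw [show (√(2 * Real.pi * 1))⁻¹ * Real.exp (-(u + z - 0) ^ 2 / (2 * 1)) *
      (Real.exp (u * (u + z) - u ^ 2 / 2) * F (u + z)) = (√(2 * Real.pi * 1))⁻¹ *
      (Real.exp (-(u + z - 0) ^ 2 / (2 * 1)) * Real.exp (u * (u + z) - u ^ 2 / 2)) * F (u + z)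
      by ring, ← Real.exp_add]
  congr 3
  ring

/-- Second-order Taylor bound in `u` for the density ratio `exp (u z - u ^ 2 / 2)`; the
coefficients are the Hermite polynomials `1`, `z`, `z ^ 2 - 1`. -/
lemma abs_gaussian_ratio_sub_le {u z : ℝ} (hu : |u| ≤ 1) :
    |Real.exp (u * z - u ^ 2 / 2) - 1 - u * z - u ^ 2 / 2 * (z ^ 2 - 1)|
      ≤ |u| ^ 3 * ((6 * Real.exp 2 + 1) * Real.exp (2 * |z|)) := by
  set w := u * z - u ^ 2 / 2 with hw
  have hu0 := abs_nonneg u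
  have hz0 := abs_nonneg z
  have hexp : |Real.exp w - (1 + w + w ^ 2 / 2)| ≤ |w| ^ 3 * Real.exp |w| := by
    have h := Complex.norm_exp_sub_sum_le_norm_mul_exp (w : ℂ) 3
    simp only [Finset.sum_range_succ, Finset.sum_range_zero, Complex.norm_real,
      Real.norm_eq_abs] at h
    rw [← Real.norm_eq_abs (Real.exp w - _), ← Complex.norm_real]
    convert h using 2
    push_cast
    norm_num [Nat.factorial]
  have hwle : |w| ≤ |u| * (|z| + 1) := by
    have h1 : w = u * (z - u / 2) := by rw [hw]; ring
    rw [h1, abs_mul]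
    gcongr
    calc |z - u / 2| ≤ |z| + |u / 2| := abs_sub _ _
      _ ≤ |z| + 1 := by rw [abs_div, abs_two]; linarith
  have hwle' : |w| ≤ |z| + 1 := hwle.trans (by nlinarith)
  have hdec : Real.exp w - 1 - u * z - u ^ 2 / 2 * (z ^ 2 - 1)
      = (Real.exp w - (1 + w + w ^ 2 / 2)) + u ^ 3 * (u / 8 - z / 2) := by rw [hw]; ring
  rw [hdec]
  have h6 : (|z| + 1) ^ 3 ≤ 6 * Real.exp (|z| + 1) := by
    have := Real.pow_div_factorial_le_exp (|z| + 1) (by positivity) 3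
    norm_num [Nat.factorial] at this
    linarith
  have hfirst : |w| ^ 3 * Real.exp |w| ≤ |u| ^ 3 * (6 * Real.exp 2 * Real.exp (2 * |z|)) := by
    calc |w| ^ 3 * Real.exp |w| ≤ (|u| * (|z| + 1)) ^ 3 * Real.exp (|z| + 1) := by gcongr
      _ = |u| ^ 3 * ((|z| + 1) ^ 3 * Real.exp (|z| + 1)) := by ring
      _ ≤ |u| ^ 3 * (6 * Real.exp (|z| + 1) * Real.exp (|z| + 1)) := by gcongr
      _ = |u| ^ 3 * (6 * Real.exp 2 * Real.exp (2 * |z|)) := by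
        rw [mul_assoc 6, mul_assoc 6, ← Real.exp_add, ← Real.exp_add]; congr 3; ring
  have hsecond : |u ^ 3 * (u / 8 - z / 2)| ≤ |u| ^ 3 * Real.exp (2 * |z|) := by
    rw [abs_mul, abs_pow]
    gcongr
    calc |u / 8 - z / 2| ≤ |u / 8| + |z / 2| := abs_sub _ _
      _ = |u| / 8 + |z| / 2 := by simp [abs_div]
      _ ≤ 2 * |z| + 1 := by linarith
      _ ≤ _ := Real.add_one_le_exp _
  calc _ ≤ _ := abs_add_le _ _
    _ ≤ |u| ^ 3 * (6 * Real.exp 2 * Real.exp (2 * |z|)) + |u| ^ 3 * Real.exp (2 * |z|) :=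
      add_le_add (hexp.trans hfirst) hsecond
    _ = _ := by ring

lemma abs_sq_sub_one_le (z : ℝ) : |z ^ 2 - 1| ≤ z ^ 2 + 1 := by
  rw [abs_le]; constructor <;> nlinarith [sq_nonneg z]

lemma integrable_lipschitz_gaussian {f : ℝ → ℝ} (hf : LipschitzWith 1 f) (u s : ℝ) :
    Integrable (fun z => f (u + s * z)) (gaussianReal 0 1) := by
  refine ((integrable_const |f u|).add (integrable_abs_gaussian.const_mul |s|)).mono'
    (hf.continuous.measurable.comp (by fun_prop)).aestronglyMeasurable
    (Filter.Eventually.of_forall fun z => ?_)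
  have := hf.dist_le_mul (u + s * z) u
  simp only [Real.dist_eq, NNReal.coe_one, one_mul, add_sub_cancel_left, abs_mul] at this
  simp only [Pi.add_apply, Real.norm_eq_abs]
  linarith [abs_sub_abs_le_abs_sub (f (u + s * z)) (f u)]

lemma abs_sub_le_of_lipschitzWith_one {f : ℝ → ℝ} (hf : LipschitzWith 1 f) (x y : ℝ) :
    |f x - f y| ≤ |x - y| := by
  simpa [Real.dist_eq] using hf.dist_le_mul x y

lemma abs_mul_sq_add_one (z : ℝ) : |z| * (z ^ 2 + 1) = |z| ^ 3 + |z| := by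
  rw [← sq_abs z]; ring

lemma integrable_lipschitz_mul_gaussian {f : ℝ → ℝ} (hf : LipschitzWith 1 f) :
    Integrable (fun z => f z * z) (gaussianReal 0 1) := by
  refine ((integrable_abs_gaussian.const_mul |f 0|).add integrable_sq_gaussian).mono'
    (hf.continuous.measurable.mul measurable_id).aestronglyMeasurable
    (Filter.Eventually.of_forall fun z => ?_)
  have h := abs_sub_le_of_lipschitzWith_one hf z 0
  have h2 := abs_sub_abs_le_abs_sub (f z) (f 0)
  simp only [Pi.add_apply, Real.norm_eq_abs, abs_mul]
  rw [sub_zero] at h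
  rw [← sq_abs z]
  nlinarith [abs_nonneg z]

lemma integrable_lipschitz_mul_sq_gaussian {f : ℝ → ℝ} (hf : LipschitzWith 1 f) :
    Integrable (fun z => f z * (z ^ 2 - 1)) (gaussianReal 0 1) := by
  refine ((((integrable_sq_gaussian.add (integrable_const 1)).const_mul |f 0|).add
    (integrable_cube_gaussian.add integrable_abs_gaussian))).mono'
    (hf.continuous.measurable.mul (by fun_prop)).aestronglyMeasurable
    (Filter.Eventually.of_forall fun z => ?_)
  have h := abs_sub_le_of_lipschitzWith_one hf z 0
  have h2 := abs_sub_abs_le_abs_sub (f z) (f 0)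
  simp only [Pi.add_apply, Real.norm_eq_abs, abs_mul]
  rw [sub_zero] at h
  rw [← abs_mul_sq_add_one]
  have h3 := abs_sq_sub_one_le z
  have h4 : |f z| ≤ |f 0| + |z| := by linarith
  calc |f z| * |z ^ 2 - 1| ≤ (|f 0| + |z|) * (z ^ 2 + 1) := by gcongr
    _ = _ := by ring

/-- For a `1`-Lipschitz `f`, the first Hermite coefficient is at most `1` in absolute value. -/
lemma abs_integral_lipschitz_mul_le {f : ℝ → ℝ} (hf : LipschitzWith 1 f) :
    |∫ z, f z * z ∂(gaussianReal 0 1)| ≤ 1 := by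
  have e : ∫ z, f z * z ∂(gaussianReal 0 1) = ∫ z, (f z - f 0) * z ∂(gaussianReal 0 1) := by
    simp_rw [sub_mul]
    rw [integral_sub (integrable_lipschitz_mul_gaussian hf)
      (integrable_id_gaussian.const_mul _), integral_const_mul]
    simp
  rw [e, ← integral_sq_gaussian]
  refine abs_integral_le_integral_of_abs_le integrable_sq_gaussian fun z => ?_
  have h := abs_sub_le_of_lipschitzWith_one hf z 0
  rw [sub_zero] at h
  rw [abs_mul, ← sq_abs z]
  nlinarith [abs_nonneg z]

/-- For a `1`-Lipschitz `f`, the second Hermite coefficient is bounded by an absolute constant. -/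
lemma abs_integral_lipschitz_mul_sq_le {f : ℝ → ℝ} (hf : LipschitzWith 1 f) :
    |∫ z, f z * (z ^ 2 - 1) ∂(gaussianReal 0 1)|
      ≤ ∫ z, (|z| ^ 3 + |z|) ∂(gaussianReal 0 1) := by
  have e : ∫ z, f z * (z ^ 2 - 1) ∂(gaussianReal 0 1)
      = ∫ z, (f z - f 0) * (z ^ 2 - 1) ∂(gaussianReal 0 1) := by
    simp_rw [sub_mul]
    rw [integral_sub (integrable_lipschitz_mul_sq_gaussian hf)
      ((integrable_fun_sub integrable_sq_gaussian (integrable_const 1)).const_mul _),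
      integral_const_mul, integral_sq_sub_one_gaussian]
    simp
  rw [e]
  refine abs_integral_le_integral_of_abs_le
    (integrable_cube_gaussian.fun_add integrable_abs_gaussian) fun z => ?_
  have h := abs_sub_le_of_lipschitzWith_one hf z 0
  rw [sub_zero] at h
  rw [abs_mul, ← abs_mul_sq_add_one]
  gcongr
  exact abs_sq_sub_one_le z

/-- Taylor expansion to second order of `u ↦ E f (u + N)` at `0`, for small `u`: the integrated form
of the bound on the density ratio. -/
lemma abs_integral_gaussian_taylor_small :
    ∃ C : ℝ, 0 < C ∧ ∀ f : ℝ → ℝ, LipschitzWith 1 f → ∀ u : ℝ, |u| ≤ 1 →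
      |(∫ z, f (u + z) ∂(gaussianReal 0 1)) - (∫ z, f z ∂(gaussianReal 0 1))
        - u * (∫ z, f z * z ∂(gaussianReal 0 1))
        - u ^ 2 / 2 * (∫ z, f z * (z ^ 2 - 1) ∂(gaussianReal 0 1))| ≤ C * |u| ^ 3 := by
  set K : ℝ := 6 * Real.exp 2 + 1 with hK
  have hKpos : 0 < K := by positivity
  have hI3 := integrable_exp_abs_gaussian 3
  refine ⟨K * (∫ z, Real.exp (3 * |z|) ∂(gaussianReal 0 1)),
    mul_pos hKpos (integral_exp_pos hI3), fun f hf u hu => ?_⟩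
  set r : ℝ → ℝ := fun z =>
    Real.exp (u * z - u ^ 2 / 2) - 1 - u * z - u ^ 2 / 2 * (z ^ 2 - 1) with hr
  have hrb : ∀ z, |r z| ≤ |u| ^ 3 * (K * Real.exp (2 * |z|)) :=
    fun z => abs_gaussian_ratio_sub_le hu
  have hri : Integrable r (gaussianReal 0 1) := by
    refine integrable_gaussian_of_le_exp (by fun_prop) (|u| ^ 3 * K) 2 (fun z => ?_)
    rw [mul_assoc]; exact hrb z
  have hid := integrable_id_gaussian
  have hexp : Integrable (fun z => Real.exp (u * z - u ^ 2 / 2)) (gaussianReal 0 1) := by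
    simp_rw [sub_eq_add_neg, Real.exp_add]
    exact (integrable_exp_mul_gaussianReal u).mul_const _
  -- The remainder has mean zero, so `f` may be replaced by `f - f 0`.
  have hr0 : ∫ z, r z ∂(gaussianReal 0 1) = 0 := by
    have h1 := integral_gaussian_shift (fun _ => 1) u
    simp only [integral_const, probReal_univ, smul_eq_mul, mul_one] at h1
    have i1 := integrable_fun_sub hexp (integrable_const (μ := gaussianReal 0 1) (1 : ℝ))
    have i2 := integrable_fun_sub i1 (hid.const_mul u)
    have i3 := (integrable_fun_sub integrable_sq_gaussian
      (integrable_const (1 : ℝ))).const_mul (u ^ 2 / 2)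
    have : ∫ z, r z ∂(gaussianReal 0 1) = ∫ z, Real.exp (u * z - u ^ 2 / 2) ∂(gaussianReal 0 1)
        - ∫ z, (1 : ℝ) ∂(gaussianReal 0 1) - ∫ z, u * z ∂(gaussianReal 0 1)
        - ∫ z, u ^ 2 / 2 * (z ^ 2 - 1) ∂(gaussianReal 0 1) := by
      rw [← integral_sub hexp (integrable_const _), ← integral_sub i1 (hid.const_mul u)]
      exact integral_sub i2 i3
    rw [this, integral_const_mul, integral_const_mul, integral_sq_sub_one_gaussian, ← h1]
    simp
  have hfrb : ∀ z, |(f z - f 0) * r z| ≤ |u| ^ 3 * K * Real.exp (3 * |z|) := fun z => by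
    have h := abs_sub_le_of_lipschitzWith_one hf z 0
    rw [sub_zero] at h
    calc |(f z - f 0) * r z| = |f z - f 0| * |r z| := abs_mul _ _
      _ ≤ Real.exp |z| * (|u| ^ 3 * (K * Real.exp (2 * |z|))) := by
        gcongr
        · exact h.trans (abs_le_exp_abs z)
        · exact hrb z
      _ = |u| ^ 3 * K * (Real.exp |z| * Real.exp (2 * |z|)) := by ring
      _ = _ := by rw [← Real.exp_add]; congr 2; ring
  have hfr : Integrable (fun z => (f z - f 0) * r z) (gaussianReal 0 1) := by
    refine integrable_gaussian_of_le_exp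
      ((hf.continuous.measurable.sub_const _).mul (by fun_prop)) (|u| ^ 3 * K) 3 hfrb
  have hbound : |∫ z, (f z - f 0) * r z ∂(gaussianReal 0 1)|
      ≤ ∫ z, |u| ^ 3 * K * Real.exp (3 * |z|) ∂(gaussianReal 0 1) := by
    refine abs_integral_le_integral_of_abs_le (hI3.const_mul _) hfrb
  have hfi : Integrable (fun z => f z) (gaussianReal 0 1) := by
    simpa using integrable_lipschitz_gaussian hf 0 1
  have hfz := integrable_lipschitz_mul_gaussian hf
  have hfz2 := integrable_lipschitz_mul_sq_gaussian hf
  have hmain : (∫ z, f (u + z) ∂(gaussianReal 0 1)) - (∫ z, f z ∂(gaussianReal 0 1))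
        - u * (∫ z, f z * z ∂(gaussianReal 0 1))
        - u ^ 2 / 2 * (∫ z, f z * (z ^ 2 - 1) ∂(gaussianReal 0 1))
      = ∫ z, (f z - f 0) * r z ∂(gaussianReal 0 1) := by
    have hF : (fun z => Real.exp (u * z - u ^ 2 / 2) * f z) = fun z =>
        (f z - f 0) * r z + f 0 * r z + f z + u * (f z * z)
          + u ^ 2 / 2 * (f z * (z ^ 2 - 1)) := by
      funext z; simp only [hr]; ring
    have j1 := hri.const_mul (f 0)
    have j2 := hfz.const_mul u
    have j3 := hfz2.const_mul (u ^ 2 / 2)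
    rw [integral_gaussian_shift, hF, integral_add (((hfr.fun_add j1).fun_add hfi).fun_add j2) j3,
      integral_add ((hfr.fun_add j1).fun_add hfi) j2, integral_add (hfr.fun_add j1) hfi,
      integral_add hfr j1, integral_const_mul, integral_const_mul, integral_const_mul, hr0]
    ring
  rw [hmain]
  refine hbound.trans (le_of_eq ?_)
  rw [integral_const_mul]; ring

/-- Taylor expansion to second order of `u ↦ E f (u + N)` at `0` for a `1`-Lipschitz `f`, with
remainder `|u| ^ p` for every exponent `p` between `2` and `3`. -/
lemma abs_integral_gaussian_taylor :
    ∃ C : ℝ, 0 < C ∧ ∀ f : ℝ → ℝ, LipschitzWith 1 f → ∀ p : ℝ, 2 ≤ p → p ≤ 3 → ∀ u : ℝ,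
      |(∫ z, f (u + z) ∂(gaussianReal 0 1)) - (∫ z, f z ∂(gaussianReal 0 1))
        - u * (∫ z, f z * z ∂(gaussianReal 0 1))
        - u ^ 2 / 2 * (∫ z, f z * (z ^ 2 - 1) ∂(gaussianReal 0 1))| ≤ C * |u| ^ p := by
  obtain ⟨C₀, hC₀, hsmall⟩ := abs_integral_gaussian_taylor_small
  set M := ∫ z, (|z| ^ 3 + |z|) ∂(gaussianReal 0 1) with hM
  have hM0 : 0 ≤ M := integral_nonneg fun z => by positivity
  refine ⟨C₀ + (2 + M), by positivity, fun f hf p hp2 hp3 u => ?_⟩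
  rcases le_or_gt |u| 1 with hu | hu
  · refine (hsmall f hf u hu).trans ?_
    have h1 : |u| ^ 3 ≤ |u| ^ p := by
      rcases eq_or_lt_of_le (abs_nonneg u) with h0 | h0
      · rw [← h0, Real.zero_rpow (by linarith)]; norm_num
      · rw [← Real.rpow_natCast |u| 3]
        exact Real.rpow_le_rpow_of_exponent_ge h0 hu (by exact_mod_cast hp3)
    have h2 : 0 ≤ |u| ^ p := by positivity
    nlinarith
  · have h1 : |u| ^ 2 ≤ |u| ^ p := by
      rw [← Real.rpow_natCast |u| 2]
      exact Real.rpow_le_rpow_of_exponent_le hu.le (by exact_mod_cast hp2)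
    have hu2 : |u| ≤ |u| ^ 2 := by nlinarith
    have hfi : Integrable (fun z => f z) (gaussianReal 0 1) := by
      simpa using integrable_lipschitz_gaussian hf 0 1
    have hfu : Integrable (fun z => f (u + z)) (gaussianReal 0 1) := by
      simpa using integrable_lipschitz_gaussian hf u 1
    have a1 : |(∫ z, f (u + z) ∂(gaussianReal 0 1)) - (∫ z, f z ∂(gaussianReal 0 1))| ≤ |u| := by
      rw [← integral_sub hfu hfi]
      have := norm_integral_le_of_norm_le (μ := gaussianReal 0 1)
        (f := fun z => f (u + z) - f z) (integrable_const |u|)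
        (Filter.Eventually.of_forall fun z => by
          simpa using abs_sub_le_of_lipschitzWith_one hf (u + z) z)
      simpa using this
    have a2 : |u * (∫ z, f z * z ∂(gaussianReal 0 1))| ≤ |u| := by
      rw [abs_mul]
      exact mul_le_of_le_one_right (abs_nonneg _) (abs_integral_lipschitz_mul_le hf)
    have a3 : |u ^ 2 / 2 * (∫ z, f z * (z ^ 2 - 1) ∂(gaussianReal 0 1))| ≤ |u| ^ 2 * M := by
      rw [abs_mul, abs_div, abs_pow, abs_two]
      have := abs_integral_lipschitz_mul_sq_le hf
      have h5 : |u| ^ 2 / 2 ≤ |u| ^ 2 := by nlinarith [sq_nonneg |u|]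
      gcongr
    calc _ ≤ |u| + |u| + |u| ^ 2 * M :=
          (abs_sub _ _).trans (add_le_add ((abs_sub _ _).trans (add_le_add a1 a2)) a3)
      _ ≤ |u| ^ 2 * (2 + M) := by nlinarith
      _ ≤ |u| ^ p * (2 + M) := by gcongr
      _ ≤ _ := by nlinarith [(by positivity : (0 : ℝ) ≤ |u| ^ p)]

/-! ### Gaussian smoothing at variance `t` -/

/-- The Gaussian smoothing `E h (x + √t N)` of `h` at variance `t`, with `N` standard normal. -/
noncomputable def gaussSmooth (h : ℝ → ℝ) (t x : ℝ) : ℝ :=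
  ∫ z, h (x + √t * z) ∂(gaussianReal 0 1)

/-- The first derivative in `x` of `gaussSmooth h t x`, written as a Gaussian integral against the
first Hermite polynomial so that `h` need not be differentiable. -/
noncomputable def gaussSmoothDeriv (h : ℝ → ℝ) (t x : ℝ) : ℝ :=
  ∫ z, h (x + √t * z) / √t * z ∂(gaussianReal 0 1)

/-- The second derivative in `x` of `gaussSmooth h t x`, written as a Gaussian integral against the
second Hermite polynomial. -/
noncomputable def gaussSmoothDeriv₂ (h : ℝ → ℝ) (t x : ℝ) : ℝ :=
  (∫ z, h (x + √t * z) / √t * (z ^ 2 - 1) ∂(gaussianReal 0 1)) / √t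

lemma lipschitzWith_one_of_abs_sub_le {f : ℝ → ℝ} (h : ∀ x y, |f x - f y| ≤ |x - y|) :
    LipschitzWith 1 f :=
  LipschitzWith.of_dist_le_mul fun x y => by simpa [Real.dist_eq] using h x y

/-- The rescaling that reduces smoothing at variance `t` to smoothing at variance `1`. -/
lemma lipschitzWith_one_rescale {h : ℝ → ℝ} (hh : LipschitzWith 1 h) {t : ℝ} (ht : 0 < t) (x : ℝ) :
    LipschitzWith 1 fun z => h (x + √t * z) / √t := by
  have hs : 0 < √t := Real.sqrt_pos.2 ht
  refine lipschitzWith_one_of_abs_sub_le fun y z => ?_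
  rw [← sub_div, abs_div, abs_of_pos hs, div_le_iff₀ hs]
  refine (abs_sub_le_of_lipschitzWith_one hh _ _).trans (le_of_eq ?_)
  rw [show x + √t * y - (x + √t * z) = (y - z) * √t by ring, abs_mul, abs_of_pos hs]

lemma abs_gaussSmooth_sub_le {h : ℝ → ℝ} (hh : LipschitzWith 1 h) (s t x y : ℝ) :
    |gaussSmooth h s x - gaussSmooth h t y| ≤ |x - y| + |√s - √t| := by
  have h1 := integrable_lipschitz_gaussian hh x √s
  have h2 := integrable_lipschitz_gaussian hh y √t
  rw [gaussSmooth, gaussSmooth, ← integral_sub h1 h2]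
  have hb : Integrable (fun z : ℝ => |x - y| + |√s - √t| * |z|) (gaussianReal 0 1) :=
    (integrable_const _).fun_add (integrable_abs_gaussian.const_mul _)
  refine (abs_integral_le_integral_of_abs_le hb fun z => ?_).trans ?_
  · refine (abs_sub_le_of_lipschitzWith_one hh _ _).trans ?_
    rw [show x + √s * z - (y + √t * z) = (x - y) + (√s - √t) * z by ring, ← abs_mul]
    exact abs_add_le _ _
  · rw [integral_add (integrable_const _) (integrable_abs_gaussian.const_mul _),
      integral_const_mul]
    simp only [integral_const, probReal_univ, smul_eq_mul, one_mul]
    gcongr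
    exact mul_le_of_le_one_right (abs_nonneg _) integral_abs_gaussian_le

lemma gaussSmooth_zero (h : ℝ → ℝ) (x : ℝ) : gaussSmooth h 0 x = h x := by
  simp [gaussSmooth]

lemma lipschitzWith_gaussSmooth {h : ℝ → ℝ} (hh : LipschitzWith 1 h) (t : ℝ) :
    LipschitzWith 1 (gaussSmooth h t) :=
  lipschitzWith_one_of_abs_sub_le fun x y => by
    simpa using abs_gaussSmooth_sub_le hh t t x y

lemma abs_gaussSmoothDeriv_le {h : ℝ → ℝ} (hh : LipschitzWith 1 h) {t : ℝ} (ht : 0 < t) (x : ℝ) :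
    |gaussSmoothDeriv h t x| ≤ 1 :=
  abs_integral_lipschitz_mul_le (lipschitzWith_one_rescale hh ht x)

lemma abs_gaussSmoothDeriv₂_le {h : ℝ → ℝ} (hh : LipschitzWith 1 h) {t : ℝ} (ht : 0 < t) (x : ℝ) :
    |gaussSmoothDeriv₂ h t x| ≤ (∫ z, (|z| ^ 3 + |z|) ∂(gaussianReal 0 1)) / √t := by
  rw [gaussSmoothDeriv₂, abs_div, abs_of_nonneg (Real.sqrt_nonneg t)]
  gcongr
  exact abs_integral_lipschitz_mul_sq_le (lipschitzWith_one_rescale hh ht x)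

lemma measurable_gaussSmooth {h : ℝ → ℝ} (hh : LipschitzWith 1 h) :
    Measurable (fun q : ℝ × ℝ => gaussSmooth h q.1 q.2) := by
  have hm := hh.continuous.measurable
  have : StronglyMeasurable (fun r : (ℝ × ℝ) × ℝ => h (r.1.2 + √r.1.1 * r.2)) :=
    (hm.comp (by fun_prop)).stronglyMeasurable
  exact (this.integral_prod_right' (ν := gaussianReal 0 1)).measurable

lemma measurable_gaussSmoothDeriv {h : ℝ → ℝ} (hh : LipschitzWith 1 h) :
    Measurable (fun q : ℝ × ℝ => gaussSmoothDeriv h q.1 q.2) := by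
  have hm := hh.continuous.measurable
  have : StronglyMeasurable
      (fun r : (ℝ × ℝ) × ℝ => h (r.1.2 + √r.1.1 * r.2) / √r.1.1 * r.2) :=
    Measurable.stronglyMeasurable (by fun_prop)
  exact (this.integral_prod_right' (ν := gaussianReal 0 1)).measurable

lemma measurable_gaussSmoothDeriv₂ {h : ℝ → ℝ} (hh : LipschitzWith 1 h) :
    Measurable (fun q : ℝ × ℝ => gaussSmoothDeriv₂ h q.1 q.2) := by
  have hm := hh.continuous.measurable
  have : StronglyMeasurable
      (fun r : (ℝ × ℝ) × ℝ => h (r.1.2 + √r.1.1 * r.2) / √r.1.1 * (r.2 ^ 2 - 1)) :=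
    Measurable.stronglyMeasurable (by fun_prop)
  exact (this.integral_prod_right' (ν := gaussianReal 0 1)).measurable.div (by fun_prop)

/-- Smoothing at variance `s + t` is smoothing at variance `t` followed by smoothing at
variance `s`. -/
lemma gaussSmooth_add {h : ℝ → ℝ} (hh : LipschitzWith 1 h) {s t : ℝ} (hs : 0 ≤ s) (ht : 0 ≤ t)
    (x : ℝ) : gaussSmooth h (t + s) x = gaussSmooth (gaussSmooth h t) s x := by
  lift s to NNReal using hs
  lift t to NNReal using ht
  have hmap : ∀ v : NNReal, (gaussianReal 0 1).map (√(v : ℝ) * ·) = gaussianReal 0 v := fun v => by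
    rw [gaussianReal_map_const_mul, mul_zero, mul_one]
    congr 1
    ext
    exact Real.sq_sqrt v.2
  have hcont := hh.continuous
  have e : ∀ v : NNReal, ∀ g : ℝ → ℝ, LipschitzWith 1 g → ∀ y,
      gaussSmooth g v y = ∫ w, g (y + w) ∂(gaussianReal 0 v) := fun v g hg y => by
    have := hg.continuous
    rw [← hmap v, integral_map (by fun_prop) (by fun_prop)]
    rfl
  have hint : Integrable (fun w => h (x + w)) (gaussianReal 0 s ∗ gaussianReal 0 t) := by
    rw [gaussianReal_conv_gaussianReal, add_zero, ← hmap (s + t),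
      integrable_map_measure (by fun_prop) (by fun_prop)]
    exact integrable_lipschitz_gaussian hh x √(s + t : NNReal)
  rw [e s _ (lipschitzWith_gaussSmooth hh t), ← NNReal.coe_add, e (t + s) h hh]
  simp_rw [e t h hh]
  have hc := integral_conv hint
  rw [gaussianReal_conv_gaussianReal, add_zero] at hc
  rw [add_comm t s, hc]
  simp_rw [add_assoc]

/-- Taylor expansion of the smoothing in `x`, with a remainder that is singular as `t → 0` at the
rate dictated by scaling. -/
lemma abs_gaussSmooth_taylor :
    ∃ C : ℝ, 0 < C ∧ ∀ h : ℝ → ℝ, LipschitzWith 1 h → ∀ p : ℝ, 2 ≤ p → p ≤ 3 →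
      ∀ t : ℝ, 0 < t → ∀ x u : ℝ,
      |gaussSmooth h t (x + u) - gaussSmooth h t x - u * gaussSmoothDeriv h t x
        - u ^ 2 / 2 * gaussSmoothDeriv₂ h t x| ≤ C * |u| ^ p * t ^ (-((p - 1) / 2)) := by
  obtain ⟨C, hC, H⟩ := abs_integral_gaussian_taylor
  refine ⟨C, hC, fun h hh p hp2 hp3 t ht x u => ?_⟩
  have hs : 0 < √t := Real.sqrt_pos.2 ht
  have key := H _ (lipschitzWith_one_rescale hh ht x) p hp2 hp3 (u / √t)
  have e1 : (∫ z, h (x + √t * (u / √t + z)) / √t ∂(gaussianReal 0 1))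
      = gaussSmooth h t (x + u) / √t := by
    rw [gaussSmooth, ← integral_div]
    congr 1 with z
    rw [mul_add, mul_div_cancel₀ _ hs.ne', add_assoc]
  have e2 : (∫ z, h (x + √t * z) / √t ∂(gaussianReal 0 1)) = gaussSmooth h t x / √t := by
    rw [gaussSmooth, ← integral_div]
  have e3 : (∫ z, h (x + √t * z) / √t * (z ^ 2 - 1) ∂(gaussianReal 0 1))
      = √t * gaussSmoothDeriv₂ h t x := by
    rw [gaussSmoothDeriv₂, mul_div_cancel₀ _ hs.ne']
  rw [e1, e2, e3] at key
  have e4 : gaussSmooth h t (x + u) - gaussSmooth h t x - u * gaussSmoothDeriv h t x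
        - u ^ 2 / 2 * gaussSmoothDeriv₂ h t x
      = √t * (gaussSmooth h t (x + u) / √t - gaussSmooth h t x / √t
        - u / √t * gaussSmoothDeriv h t x
        - (u / √t) ^ 2 / 2 * (√t * gaussSmoothDeriv₂ h t x)) := by
    field_simp
  rw [e4, abs_mul, abs_of_pos hs]
  calc √t * _ ≤ √t * (C * |u / √t| ^ p) := mul_le_mul_of_nonneg_left key hs.le
    _ = C * |u| ^ p * (√t / √t ^ p) := by
      rw [abs_div, abs_of_pos hs, Real.div_rpow (abs_nonneg u) hs.le]; ring
    _ = C * |u| ^ p * t ^ (-((p - 1) / 2)) := by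
      congr 1
      rw [Real.sqrt_eq_rpow, ← Real.rpow_mul ht.le, ← Real.rpow_sub ht]
      congr 1; ring

/-- Expansion of the smoothing in the variance. It follows from the expansion in `x` by the
semigroup property: this replaces the heat equation. -/
lemma abs_gaussSmooth_add_variance :
    ∃ C : ℝ, 0 < C ∧ ∀ h : ℝ → ℝ, LipschitzWith 1 h → ∀ p : ℝ, 2 ≤ p → p ≤ 3 →
      ∀ t : ℝ, 0 < t → ∀ s : ℝ, 0 ≤ s → ∀ x : ℝ,
      |gaussSmooth h (t + s) x - gaussSmooth h t x - s / 2 * gaussSmoothDeriv₂ h t x|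
        ≤ C * s ^ (p / 2) * t ^ (-((p - 1) / 2)) := by
  obtain ⟨C, hC, H⟩ := abs_gaussSmooth_taylor
  have hmom : Integrable (fun z : ℝ => 1 + |z| ^ 3) (gaussianReal 0 1) :=
    (integrable_const 1).fun_add integrable_cube_gaussian
  set M := ∫ z, (1 + |z| ^ 3) ∂(gaussianReal 0 1) with hM
  have hM0 : 0 < M := by
    rw [hM, integral_add (integrable_const 1) integrable_cube_gaussian]
    have : 0 ≤ ∫ z, |z| ^ 3 ∂(gaussianReal 0 1) := integral_nonneg fun z => by positivity
    simp only [integral_const, probReal_univ, smul_eq_mul, one_mul]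
    linarith
  refine ⟨C * M, by positivity, fun h hh p hp2 hp3 t ht s hs x => ?_⟩
  have hφ := lipschitzWith_gaussSmooth hh t
  have i1 := integrable_lipschitz_gaussian hφ x √s
  have i2 : Integrable (fun z : ℝ => √s * z * gaussSmoothDeriv h t x) (gaussianReal 0 1) :=
    (integrable_id_gaussian.const_mul _).mul_const _
  have i3 : Integrable (fun z : ℝ => (√s * z) ^ 2 / 2 * gaussSmoothDeriv₂ h t x)
      (gaussianReal 0 1) := by
    simp_rw [mul_pow]
    exact ((integrable_sq_gaussian.const_mul _).div_const _).mul_const _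
  have e : gaussSmooth h (t + s) x - gaussSmooth h t x - s / 2 * gaussSmoothDeriv₂ h t x
      = ∫ z, (gaussSmooth h t (x + √s * z) - gaussSmooth h t x - √s * z * gaussSmoothDeriv h t x
        - (√s * z) ^ 2 / 2 * gaussSmoothDeriv₂ h t x) ∂(gaussianReal 0 1) := by
    rw [integral_sub (integrable_fun_sub (integrable_fun_sub i1 (integrable_const _)) i2) i3,
      integral_sub (integrable_fun_sub i1 (integrable_const _)) i2,
      integral_sub i1 (integrable_const _), gaussSmooth_add hh hs ht.le]
    simp_rw [mul_pow, Real.sq_sqrt hs]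
    rw [integral_mul_const, integral_mul_const, integral_const_mul, integral_div,
      integral_const_mul, integral_sq_gaussian, integral_id_gaussianReal]
    simp [gaussSmooth]
  rw [e]
  have hb := hmom.const_mul (C * s ^ (p / 2) * t ^ (-((p - 1) / 2)))
  refine (abs_integral_le_integral_of_abs_le hb fun z => ?_).trans (le_of_eq ?_)
  · refine (H h hh p hp2 hp3 t ht x (√s * z)).trans ?_
    have hz : |z| ^ p ≤ 1 + |z| ^ 3 := by
      rcases le_total |z| 1 with h1 | h1
      · have := Real.rpow_le_one (abs_nonneg z) h1 (by linarith : 0 ≤ p)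
        have := pow_nonneg (abs_nonneg z) 3
        linarith
      · have h2 : |z| ^ p ≤ |z| ^ (3 : ℝ) := Real.rpow_le_rpow_of_exponent_le h1 hp3
        rw [show (3 : ℝ) = (3 : ℕ) by norm_num, Real.rpow_natCast] at h2
        linarith
    rw [abs_mul, Real.mul_rpow (abs_nonneg _) (abs_nonneg _), abs_of_nonneg (Real.sqrt_nonneg s),
      Real.sqrt_eq_rpow, ← Real.rpow_mul hs, show 1 / 2 * p = p / 2 by ring]
    calc C * (s ^ (p / 2) * |z| ^ p) * t ^ (-((p - 1) / 2))
        = C * s ^ (p / 2) * t ^ (-((p - 1) / 2)) * |z| ^ p := by ring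
      _ ≤ _ := by gcongr
  · rw [integral_const_mul]; ring

/-! ### Duality for the `L¹` distance of distribution functions -/

/-- The signed indicator `1_{y < x} - 1_{y < 0}` of the interval between `0` and `x`. -/
noncomputable def signedInterval (x y : ℝ) : ℝ :=
  (Set.Iio x).indicator 1 y - (Set.Iio 0).indicator 1 y

lemma measurable_signedInterval : Measurable (fun q : ℝ × ℝ => signedInterval q.1 q.2) := by
  have h1 : Measurable (fun q : ℝ × ℝ => (Set.Iio q.1).indicator (1 : ℝ → ℝ) q.2) := by
    have : (fun q : ℝ × ℝ => (Set.Iio q.1).indicator (1 : ℝ → ℝ) q.2)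
        = {q : ℝ × ℝ | q.2 < q.1}.indicator 1 := by
      ext q; simp [Set.indicator]
    rw [this]
    exact measurable_one.indicator (measurableSet_lt measurable_snd measurable_fst)
  have h2 : Measurable (fun q : ℝ × ℝ => (Set.Iio (0 : ℝ)).indicator (1 : ℝ → ℝ) q.2) :=
    (measurable_one.indicator measurableSet_Iio).comp measurable_snd
  exact h1.sub h2

lemma abs_signedInterval_sub (x x' y : ℝ) :
    |signedInterval x y - signedInterval x' y|
      = (Set.Ico (min x x') (max x x')).indicator (fun _ => (1 : ℝ)) y := by
  simp only [signedInterval, Set.indicator, Set.mem_Iio, Set.mem_Ico, Pi.one_apply, min_le_iff,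
    lt_max_iff, sub_sub_sub_cancel_right]
  grind

lemma signedInterval_zero (y : ℝ) : signedInterval 0 y = 0 := sub_self _

lemma integrable_Ico_indicator (a b : ℝ) :
    Integrable ((Set.Ico a b).indicator (fun _ => (1 : ℝ))) :=
  (integrable_indicator_iff measurableSet_Ico).2 (integrableOn_const (by simp))

lemma integrable_mul_signedInterval {s : ℝ → ℝ} (hs : Measurable s) (hs1 : ∀ y, |s y| ≤ 1)
    (x : ℝ) : Integrable (fun y => s y * signedInterval x y) := by
  refine (integrable_Ico_indicator (min x 0) (max x 0)).mono'
    (hs.mul (measurable_signedInterval.comp measurable_prodMk_left)).aestronglyMeasurable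
    (Filter.Eventually.of_forall fun y => ?_)
  rw [← abs_signedInterval_sub, signedInterval_zero, sub_zero, Real.norm_eq_abs, abs_mul]
  exact mul_le_of_le_one_left (abs_nonneg _) (hs1 y)

/-- The Lipschitz function with derivative `s` that vanishes at `0`. -/
noncomputable def primitiveFrom (s : ℝ → ℝ) (x : ℝ) : ℝ := ∫ y, s y * signedInterval x y

lemma integral_Ico_indicator (x x' : ℝ) :
    ∫ y, (Set.Ico (min x x') (max x x')).indicator (fun _ => (1 : ℝ)) y = |x - x'| := by
  rw [integral_indicator measurableSet_Ico]
  simp [max_sub_min_eq_abs, abs_sub_comm]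

lemma lipschitzWith_primitiveFrom {s : ℝ → ℝ} (hs : Measurable s) (hs1 : ∀ y, |s y| ≤ 1) :
    LipschitzWith 1 (primitiveFrom s) := by
  refine lipschitzWith_one_of_abs_sub_le fun x x' => ?_
  rw [primitiveFrom, primitiveFrom, ← integral_sub (integrable_mul_signedInterval hs hs1 x)
    (integrable_mul_signedInterval hs hs1 x'), ← integral_Ico_indicator]
  refine abs_integral_le_integral_of_abs_le (integrable_Ico_indicator _ _) fun y => ?_
  rw [← mul_sub, abs_mul, abs_signedInterval_sub]
  exact mul_le_of_le_one_left (Set.indicator_nonneg (fun _ _ => zero_le_one) _) (hs1 y)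

lemma integral_signedInterval (P : Measure ℝ) [IsProbabilityMeasure P] (y : ℝ) :
    ∫ x, signedInterval x y ∂P = 1 - cdf P y - (Set.Iio (0 : ℝ)).indicator 1 y := by
  have h1 : ∀ x, signedInterval x y
      = (Set.Ioi y).indicator (fun _ => (1 : ℝ)) x - (Set.Iio (0 : ℝ)).indicator 1 y := fun x => by
    simp [signedInterval, Set.indicator]
  simp_rw [h1]
  rw [integral_sub ((integrable_const _).indicator measurableSet_Ioi) (integrable_const _),
    integral_indicator measurableSet_Ioi, cdf_eq_real,
    ← probReal_compl_eq_one_sub measurableSet_Iic, Set.compl_Iic]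
  simp

lemma integrable_prod_mul_signedInterval (P : Measure ℝ) [IsProbabilityMeasure P]
    (hP : Integrable (fun x => x) P) {s : ℝ → ℝ} (hs : Measurable s) (hs1 : ∀ y, |s y| ≤ 1) :
    Integrable (fun q : ℝ × ℝ => s q.2 * signedInterval q.1 q.2) (P.prod volume) := by
  have hm : Measurable (fun q : ℝ × ℝ => s q.2 * signedInterval q.1 q.2) :=
    (hs.comp measurable_snd).mul measurable_signedInterval
  rw [integrable_prod_iff hm.aestronglyMeasurable]
  refine ⟨Filter.Eventually.of_forall (integrable_mul_signedInterval hs hs1), ?_⟩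
  refine hP.abs.mono' (hm.norm.stronglyMeasurable.integral_prod_right').aestronglyMeasurable
    (Filter.Eventually.of_forall fun x => ?_)
  rw [Real.norm_eq_abs, abs_of_nonneg (integral_nonneg fun y => norm_nonneg _)]
  have h0 := integral_Ico_indicator x 0
  rw [sub_zero] at h0
  rw [← h0]
  refine integral_mono (integrable_mul_signedInterval hs hs1 x).norm
    (integrable_Ico_indicator _ _) fun y => ?_
  simp only
  rw [← abs_signedInterval_sub, signedInterval_zero, sub_zero, Real.norm_eq_abs, abs_mul]
  exact mul_le_of_le_one_left (abs_nonneg _) (hs1 y)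

/-- The `L¹` distance of two distribution functions is attained as a difference of expectations of
a `1`-Lipschitz function: the one whose derivative is the sign of the difference. -/
lemma lintegral_cdf_sub_le (P Q : Measure ℝ) [IsProbabilityMeasure P] [IsProbabilityMeasure Q]
    (hP : Integrable (fun x => x) P) (hQ : Integrable (fun x => x) Q) (K : ℝ)
    (hK : ∀ h : ℝ → ℝ, LipschitzWith 1 h → ∫ x, h x ∂P - ∫ x, h x ∂Q ≤ K) :
    ∫⁻ x : ℝ, ENNReal.ofReal |cdf P x - cdf Q x| ≤ ENNReal.ofReal K := by
  have hcP : Measurable (cdf P) := (monotone_cdf P).measurable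
  have hcQ : Measurable (cdf Q) := (monotone_cdf Q).measurable
  set s : ℝ → ℝ := fun y => if cdf P y ≤ cdf Q y then 1 else -1 with hsdef
  have hs : Measurable s :=
    Measurable.ite (measurableSet_le hcP hcQ) measurable_const measurable_const
  have hs1 : ∀ y, |s y| ≤ 1 := fun y => by
    simp only [hsdef]; split_ifs <;> simp
  have key : ∀ (ν : Measure ℝ) [IsProbabilityMeasure ν], Integrable (fun x => x) ν →
      Integrable (fun y => s y * (1 - cdf ν y - (Set.Iio (0 : ℝ)).indicator 1 y)) ∧
      ∫ x, primitiveFrom s x ∂ν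
        = ∫ y, s y * (1 - cdf ν y - (Set.Iio (0 : ℝ)).indicator 1 y) := fun ν _ hν => by
    have hi := integrable_prod_mul_signedInterval ν hν hs hs1
    have e : ∀ y, ∫ x, s y * signedInterval x y ∂ν
        = s y * (1 - cdf ν y - (Set.Iio (0 : ℝ)).indicator 1 y) := fun y => by
      rw [integral_const_mul, integral_signedInterval]
    constructor
    · simpa only [e] using hi.integral_prod_right
    · simp only [primitiveFrom]
      rw [integral_integral_swap hi]
      simp only [e]
  obtain ⟨iP, eP⟩ := key P hP
  obtain ⟨iQ, eQ⟩ := key Q hQ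
  have habs : ∀ y, |cdf P y - cdf Q y| = s y * (1 - cdf P y - (Set.Iio (0 : ℝ)).indicator 1 y)
      - s y * (1 - cdf Q y - (Set.Iio (0 : ℝ)).indicator 1 y) := fun y => by
    simp only [hsdef]
    split_ifs with hy
    · rw [abs_of_nonpos (by linarith)]; ring
    · rw [abs_of_nonneg (by linarith)]; ring
  have hint : Integrable (fun y => |cdf P y - cdf Q y|) := by
    simp_rw [habs]; exact integrable_fun_sub iP iQ
  rw [← ofReal_integral_eq_lintegral_ofReal hint
    (Filter.Eventually.of_forall fun y => abs_nonneg _)]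
  refine ENNReal.ofReal_le_ofReal ?_
  have := hK _ (lipschitzWith_primitiveFrom hs hs1)
  rw [eP, eQ, ← integral_sub iP iQ] at this
  simpa only [habs] using this

/-! ### One replacement step -/

/-- Replacing an increment `u` by a Gaussian increment of variance `v`: the difference is a linear
term, a variance mismatch, and a remainder. -/
lemma gaussSmooth_replace_le :
    ∃ C : ℝ, 0 < C ∧ ∀ h : ℝ → ℝ, LipschitzWith 1 h → ∀ p : ℝ, 2 ≤ p → p ≤ 3 →
      ∀ t : ℝ, 0 < t → ∀ v : ℝ, 0 ≤ v → ∀ x u : ℝ,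
      gaussSmooth h t (x + u) - gaussSmooth h (t + v) x
        ≤ gaussSmoothDeriv h t x * u
          + gaussSmoothDeriv₂ h t x / 2 * u ^ 2 - gaussSmoothDeriv₂ h t x / 2 * v
          + C * t ^ (-((p - 1) / 2)) * |u| ^ p + C * t ^ (-((p - 1) / 2)) * v ^ (p / 2) := by
  obtain ⟨C₁, hC₁, H₁⟩ := abs_gaussSmooth_taylor
  obtain ⟨C₂, hC₂, H₂⟩ := abs_gaussSmooth_add_variance
  refine ⟨C₁ + C₂, by positivity, fun h hh p hp2 hp3 t ht v hv x u => ?_⟩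
  have h1 := (abs_le.1 (H₁ h hh p hp2 hp3 t ht x u)).2
  have h2 := (abs_le.1 (H₂ h hh p hp2 hp3 t ht v hv x)).1
  have n1 : 0 ≤ C₂ * t ^ (-((p - 1) / 2)) * |u| ^ p := by positivity
  have n2 : 0 ≤ C₁ * t ^ (-((p - 1) / 2)) * v ^ (p / 2) := by positivity
  nlinarith

lemma integral_mul_eq_of_condExp {Ω : Type*} {m m0 : MeasurableSpace Ω} {μ : Measure Ω}
    [IsProbabilityMeasure μ] (hm : m ≤ m0) {G Y Z : Ω → ℝ} (hG : Measurable[m] G) {c : ℝ}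
    (hGc : ∀ ω, |G ω| ≤ c) (hY : Integrable Y μ) (hZ : μ[Y | m] =ᵐ[μ] Z) :
    ∫ ω, G ω * Y ω ∂μ = ∫ ω, G ω * Z ω ∂μ := by
  have h := condExp_stronglyMeasurable_mul_of_bound hm hG.stronglyMeasurable hY c
    (Filter.Eventually.of_forall hGc)
  rw [← integral_condExp hm (f := fun ω => G ω * Y ω)]
  refine integral_congr_ae (h.trans ?_)
  filter_upwards [hZ] with ω hω
  simp [hω]

lemma integrable_mul_of_abs_le {Ω : Type*} {m0 : MeasurableSpace Ω} {μ : Measure Ω}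
    {G Y : Ω → ℝ} (hG : Measurable G) {c : ℝ} (hGc : ∀ ω, |G ω| ≤ c) (hY : Integrable Y μ) :
    Integrable (fun ω => G ω * Y ω) μ :=
  hY.bdd_mul hG.aestronglyMeasurable (Filter.Eventually.of_forall hGc)

lemma integrable_gaussSmooth {Ω : Type*} {m0 : MeasurableSpace Ω} {μ : Measure Ω}
    [IsProbabilityMeasure μ] {h : ℝ → ℝ} (hh : LipschitzWith 1 h) {S T : Ω → ℝ}
    (hS : Integrable S μ) (hSm : Measurable S) (hTm : Measurable T) {M : ℝ}
    (hTM : ∀ᵐ ω ∂μ, T ω ≤ M) :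
    Integrable (fun ω => gaussSmooth h (T ω) (S ω)) μ := by
  refine (((integrable_const |h 0|).add hS.abs).add (integrable_const √M)).mono'
    ((measurable_gaussSmooth hh).comp (hTm.prodMk hSm)).aestronglyMeasurable ?_
  filter_upwards [hTM] with ω hω
  have h1 := abs_gaussSmooth_sub_le hh (T ω) 0 (S ω) 0
  rw [gaussSmooth_zero, Real.sqrt_zero, sub_zero, sub_zero,
    abs_of_nonneg (Real.sqrt_nonneg _)] at h1
  have h2 := abs_sub_abs_le_abs_sub (gaussSmooth h (T ω) (S ω)) (h 0)
  have h3 := Real.sqrt_le_sqrt hω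
  simp only [Pi.add_apply, Real.norm_eq_abs]
  linarith

/-- Lindeberg replacement of one martingale increment `ξ` by a Gaussian increment with the same
conditional variance `v`, under a conditional Lyapunov bound on `ξ`. -/
lemma integral_gaussSmooth_replace_le :
    ∃ C : ℝ, 0 < C ∧ ∀ (h : ℝ → ℝ), LipschitzWith 1 h → ∀ ρ : ℝ, 0 < ρ → ρ ≤ 1 →
      ∀ (Ω : Type*) (m m0 : MeasurableSpace Ω) (μ : Measure Ω) (_ : IsProbabilityMeasure μ)
      (_ : m ≤ m0) (S T v ξ : Ω → ℝ) (ε c M : ℝ), 0 < ε → 0 < c →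
      Measurable[m] S → Measurable[m] T → Measurable[m] v → Measurable ξ → Integrable S μ →
      (∀ ω, c ≤ T ω) → (∀ ω, T ω ≤ M) → (∀ ω, 0 ≤ v ω) → (∀ᵐ ω ∂μ, v ω ≤ ε ^ 2) →
      Integrable ξ μ → Integrable (fun ω => ξ ω ^ 2) μ →
      Integrable (fun ω => |ξ ω| ^ (2 + ρ)) μ →
      μ[ξ | m] =ᵐ[μ] 0 → μ[fun ω => ξ ω ^ 2 | m] =ᵐ[μ] v →
      μ[fun ω => |ξ ω| ^ (2 + ρ) | m] ≤ᵐ[μ] (fun ω => ε ^ ρ * v ω) →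
      ∫ ω, gaussSmooth h (T ω) (S ω + ξ ω) ∂μ - ∫ ω, gaussSmooth h (T ω + v ω) (S ω) ∂μ
        ≤ C * ε ^ ρ * ∫ ω, T ω ^ (-((1 + ρ) / 2)) * v ω ∂μ := by
  obtain ⟨C, hC, H⟩ := gaussSmooth_replace_le
  refine ⟨2 * C, by positivity, ?_⟩
  intro h hh ρ hρ0 hρ1 Ω m m0 μ _ hm S T v ξ ε c M hε hc hS hT hv hξ hSi hTc hTM hv0 hvε
    hξ1 hξ2 hξp e1 e2 ep
  have hT0 : ∀ ω, 0 < T ω := fun ω => hc.trans_le (hTc ω)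
  set D : Ω → ℝ := fun ω => gaussSmoothDeriv h (T ω) (S ω) with hD
  set E : Ω → ℝ := fun ω => gaussSmoothDeriv₂ h (T ω) (S ω) / 2 with hE
  set w : Ω → ℝ := fun ω => T ω ^ (-((1 + ρ) / 2)) with hw
  have hDm : Measurable[m] D := (measurable_gaussSmoothDeriv hh).comp (hT.prodMk hS)
  have hEm : Measurable[m] E :=
    ((measurable_gaussSmoothDeriv₂ hh).comp (hT.prodMk hS)).div_const 2
  have hwm : Measurable[m] w := hT.pow_const _
  have hDb : ∀ ω, |D ω| ≤ 1 := fun ω => abs_gaussSmoothDeriv_le hh (hT0 ω) _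
  set B := ∫ z, (|z| ^ 3 + |z|) ∂(gaussianReal 0 1) with hB
  have hB0 : 0 ≤ B := integral_nonneg fun z => by positivity
  have hEb : ∀ ω, |E ω| ≤ B / √c := fun ω => by
    have h1 := abs_gaussSmoothDeriv₂_le hh (hT0 ω) (S ω)
    have h2 : B / √(T ω) ≤ B / √c := by
      have := Real.sqrt_pos.2 hc
      have := Real.sqrt_le_sqrt (hTc ω)
      gcongr
    simp only [hE, abs_div, abs_two]
    have := abs_nonneg (gaussSmoothDeriv₂ h (T ω) (S ω))
    linarith
  have hw0 : ∀ ω, 0 ≤ w ω := fun ω => Real.rpow_nonneg (hT0 ω).le _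
  have hwb : ∀ ω, |w ω| ≤ c ^ (-((1 + ρ) / 2)) := fun ω => by
    rw [abs_of_nonneg (hw0 ω)]
    exact Real.rpow_le_rpow_of_nonpos hc (hTc ω) (by linarith)
  have hvi : Integrable v μ := integrable_condExp.congr e2
  have hS0 := hS.mono hm le_rfl
  have hT0m := hT.mono hm le_rfl
  have hv0m := hv.mono hm le_rfl
  have hD0 := hDm.mono hm le_rfl
  have hE0 := hEm.mono hm le_rfl
  have hw0m := hwm.mono hm le_rfl
  have i1 := integrable_mul_of_abs_le hD0 hDb hξ1
  have i2 := integrable_mul_of_abs_le hE0 hEb hξ2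
  have i3 := integrable_mul_of_abs_le hE0 hEb hvi
  have i4 := integrable_mul_of_abs_le hw0m hwb hξp
  have i5 := integrable_mul_of_abs_le hw0m hwb hvi
  have l1 : Integrable (fun ω => gaussSmooth h (T ω) (S ω + ξ ω)) μ :=
    integrable_gaussSmooth hh (hSi.add hξ1) (hS0.add hξ) hT0m (Filter.Eventually.of_forall hTM)
  have l2 : Integrable (fun ω => gaussSmooth h (T ω + v ω) (S ω)) μ :=
    integrable_gaussSmooth hh hSi hS0 (hT0m.add hv0m) (M := M + ε ^ 2)
      (by filter_upwards [hvε] with ω hω using add_le_add (hTM ω) hω)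
  have c1 : ∫ ω, D ω * ξ ω ∂μ = 0 := by
    rw [integral_mul_eq_of_condExp hm hDm hDb hξ1 e1]; simp
  have c2 : ∫ ω, E ω * ξ ω ^ 2 ∂μ = ∫ ω, E ω * v ω ∂μ :=
    integral_mul_eq_of_condExp hm hEm hEb hξ2 e2
  have c3 : ∫ ω, w ω * |ξ ω| ^ (2 + ρ) ∂μ ≤ ε ^ ρ * ∫ ω, w ω * v ω ∂μ := by
    rw [integral_mul_eq_of_condExp hm hwm hwb hξp Filter.EventuallyEq.rfl, ← integral_const_mul]
    refine integral_mono_ae (integrable_mul_of_abs_le hw0m hwb integrable_condExp)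
      (i5.const_mul _) ?_
    filter_upwards [ep] with ω hω
    calc w ω * _ ≤ w ω * (ε ^ ρ * v ω) := mul_le_mul_of_nonneg_left hω (hw0 ω)
      _ = _ := by ring
  have hpt : ∀ᵐ ω ∂μ, gaussSmooth h (T ω) (S ω + ξ ω) - gaussSmooth h (T ω + v ω) (S ω)
      ≤ D ω * ξ ω + E ω * ξ ω ^ 2 - E ω * v ω + C * (w ω * |ξ ω| ^ (2 + ρ))
        + C * ε ^ ρ * (w ω * v ω) := by
    filter_upwards [hvε] with ω hω
    have h1 := H h hh (2 + ρ) (by linarith) (by linarith) (T ω) (hT0 ω) (v ω) (hv0 ω) (S ω) (ξ ω)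
    have hvp : v ω ^ ((2 + ρ) / 2) ≤ ε ^ ρ * v ω := by
      rcases eq_or_lt_of_le (hv0 ω) with h0 | h0
      · rw [← h0, Real.zero_rpow (by linarith)]; simp
      · rw [show (2 + ρ) / 2 = ρ / 2 + 1 by ring, Real.rpow_add h0, Real.rpow_one]
        have h3 : v ω ^ (ρ / 2) ≤ (ε ^ 2) ^ (ρ / 2) :=
          Real.rpow_le_rpow (hv0 ω) hω (by linarith)
        have h4 : (ε ^ 2) ^ (ρ / 2) = ε ^ ρ := by
          rw [← Real.rpow_natCast, ← Real.rpow_mul hε.le]; congr 1; push_cast; ring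
        rw [h4] at h3
        exact mul_le_mul_of_nonneg_right h3 h0.le
    rw [show -((2 + ρ - 1) / 2) = -((1 + ρ) / 2) by ring] at h1
    have h5 : C * w ω * v ω ^ ((2 + ρ) / 2) ≤ C * w ω * (ε ^ ρ * v ω) :=
      mul_le_mul_of_nonneg_left hvp (mul_nonneg hC.le (hw0 ω))
    simp only [hD, hE, hw] at h5 ⊢
    linarith
  have j4 := i4.const_mul C
  have j5 := i5.const_mul (C * ε ^ ρ)
  rw [← integral_sub l1 l2]
  refine (integral_mono_ae (integrable_fun_sub l1 l2)
    (((integrable_fun_sub (i1.fun_add i2) i3).fun_add j4).fun_add j5) hpt).trans ?_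
  rw [integral_add ((integrable_fun_sub (i1.fun_add i2) i3).fun_add j4) j5,
    integral_add (integrable_fun_sub (i1.fun_add i2) i3) j4,
    integral_sub (i1.fun_add i2) i3, integral_add i1 i2, integral_const_mul, integral_const_mul,
    c1, c2]
  have := mul_le_mul_of_nonneg_left c3 hC.le
  linarith

/-! ### The deterministic sum over the remaining variances -/

/-- Comparison of `s t⁻ʳ` with the increment of `t ^ (1 - r)`. -/
lemma mul_rpow_neg_le_of_lt_one {r : ℝ} (hr0 : 0 < r) (hr1 : r < 1) {t s : ℝ} (ht : 0 < t)
    (hs : 0 ≤ s) (hst : s ≤ t) :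
    t ^ (-r) * s ≤ 2 / (1 - r) * ((t + s) ^ (1 - r) - t ^ (1 - r)) := by
  have h1r : 0 < 1 - r := by linarith
  have hts : 0 < t + s := by linarith
  -- Bernoulli's inequality with exponent `1 - r ≤ 1`, based at `t + s`.
  have hb := rpow_one_add_le_one_add_mul_self (s := -(s / (t + s))) (p := 1 - r)
    (by rw [neg_le_neg_iff, div_le_one hts]; linarith) h1r.le (by linarith)
  have e : 1 + -(s / (t + s)) = t / (t + s) := by field_simp; ring
  rw [e, Real.div_rpow ht.le hts.le, div_le_iff₀ (Real.rpow_pos_of_pos hts _)] at hb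
  have e2 : (t + s) ^ (1 - r) = (t + s) ^ (-r) * (t + s) := by
    rw [← Real.rpow_add_one hts.ne']; congr 1; ring
  have hb2 : (1 - r) * ((t + s) ^ (-r) * s) ≤ (t + s) ^ (1 - r) - t ^ (1 - r) := by
    have : (1 - r) * (s / (t + s)) * (t + s) ^ (1 - r) = (1 - r) * ((t + s) ^ (-r) * s) := by
      rw [e2]; field_simp
    linarith
  have h2 : t ^ (-r) ≤ 2 * (t + s) ^ (-r) := by
    have h3 : (2 * t) ^ (-r) ≤ (t + s) ^ (-r) :=
      Real.rpow_le_rpow_of_nonpos hts (by linarith) (by linarith)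
    rw [Real.mul_rpow (by norm_num) ht.le] at h3
    have h4 : (2 : ℝ) ^ (-1 : ℝ) ≤ 2 ^ (-r) :=
      Real.rpow_le_rpow_of_exponent_le (by norm_num) (by linarith)
    rw [Real.rpow_neg_one] at h4
    have := Real.rpow_pos_of_pos ht (-r)
    nlinarith
  rw [div_mul_eq_mul_div, le_div_iff₀ h1r]
  nlinarith [mul_le_mul_of_nonneg_right h2 hs]

/-- Comparison of `s / t` with the increment of the logarithm. -/
lemma mul_rpow_neg_one_le {t s : ℝ} (ht : 0 < t) (hs : 0 ≤ s) (hst : s ≤ t) :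
    t ^ (-1 : ℝ) * s ≤ 2 * (Real.log (t + s) - Real.log t) := by
  have hts : 0 < t + s := by linarith
  have h := Real.log_le_sub_one_of_pos (div_pos ht hts)
  rw [Real.log_div ht.ne' hts.ne'] at h
  have e : t / (t + s) - 1 = -(s / (t + s)) := by field_simp; ring
  rw [e] at h
  have h2 : t ^ (-1 : ℝ) * s ≤ 2 * (s / (t + s)) := by
    rw [Real.rpow_neg_one, inv_mul_eq_div, ← mul_div_assoc, div_le_div_iff₀ ht hts]
    nlinarith
  linarith

/-- The logarithmic factor that separates the case `ρ = 1` from the case `ρ < 1`. -/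
noncomputable def logFactor (ρ ε : ℝ) : ℝ := if ρ < 1 then 1 else |Real.log ε|

lemma half_le_abs_log {ε : ℝ} (hε0 : 0 < ε) (hε : ε ≤ 1 / 2) : 1 / 2 ≤ |Real.log ε| := by
  have h1 := Real.log_le_log hε0 hε
  rw [one_div, Real.log_inv] at h1
  have := Real.log_two_gt_d9
  rw [abs_of_nonpos (by linarith)]
  linarith

/-- If `T k` decreases from `T 0 ≤ 2` by steps `v (k + 1) ≤ ε ^ 2`, staying above `ε ^ 2`, then
`∑ v / T ^ ((1 + ρ) / 2)` is comparable to the integral `∫_{ε ^ 2}^2 t ^ (-(1 + ρ) / 2) dt`. -/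
lemma sum_rpow_mul_le {ρ : ℝ} (hρ0 : 0 < ρ) (hρ1 : ρ ≤ 1) :
    ∃ L : ℝ, 0 < L ∧ ∀ (n : ℕ) (T v : ℕ → ℝ) (ε : ℝ), 0 < ε → ε ≤ 1 / 2 → T 0 ≤ 2 →
      (∀ k, ε ^ 2 ≤ T k) → (∀ k, 0 ≤ v k) → (∀ k < n, v (k + 1) ≤ ε ^ 2) →
      (∀ k < n, T k = T (k + 1) + v (k + 1)) →
      ∑ k ∈ Finset.range n, T (k + 1) ^ (-((1 + ρ) / 2)) * v (k + 1) ≤ L * logFactor ρ ε := by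
  have telescope : ∀ (G : ℝ → ℝ) (A : ℝ) (n : ℕ) (T v : ℕ → ℝ),
      (∀ k < n, T (k + 1) ^ (-((1 + ρ) / 2)) * v (k + 1)
        ≤ A * (G (T (k + 1) + v (k + 1)) - G (T (k + 1)))) →
      (∀ k < n, T k = T (k + 1) + v (k + 1)) →
      ∑ k ∈ Finset.range n, T (k + 1) ^ (-((1 + ρ) / 2)) * v (k + 1)
        ≤ A * (G (T 0) - G (T n)) := fun G A n T v h hT => by
    rw [← Finset.sum_range_sub' (fun k => G (T k)), Finset.mul_sum]
    refine Finset.sum_le_sum fun k hk => ?_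
    have hk := Finset.mem_range.1 hk
    rw [hT k hk]
    exact h k hk
  rcases lt_or_eq_of_le hρ1 with hlt | rfl
  · refine ⟨2 / (1 - (1 + ρ) / 2) * 2, by
      have : 0 < 1 - (1 + ρ) / 2 := by linarith
      positivity, fun n T v ε hε hε2 hT0 hTε hv0 hvε hT => ?_⟩
    have hc : 0 < 1 - (1 + ρ) / 2 := by linarith
    have hpos : ∀ k, 0 < T k := fun k => (by positivity : 0 < ε ^ 2).trans_le (hTε k)
    refine (telescope (fun t => t ^ (1 - (1 + ρ) / 2)) (2 / (1 - (1 + ρ) / 2)) n T v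
      (fun k hk => mul_rpow_neg_le_of_lt_one (by linarith) (by linarith) (hpos _) (hv0 _)
        ((hvε k hk).trans (hTε _))) hT).trans ?_
    rw [logFactor, if_pos hlt, mul_one]
    refine mul_le_mul_of_nonneg_left ?_ (by positivity)
    have h1 : T 0 ^ (1 - (1 + ρ) / 2) ≤ 2 ^ (1 - (1 + ρ) / 2) :=
      Real.rpow_le_rpow (hpos 0).le hT0 hc.le
    have h2 : (2 : ℝ) ^ (1 - (1 + ρ) / 2) ≤ 2 ^ (1 : ℝ) :=
      Real.rpow_le_rpow_of_exponent_le (by norm_num) (by linarith)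
    rw [Real.rpow_one] at h2
    have h3 := Real.rpow_nonneg (hpos n).le (1 - (1 + ρ) / 2)
    linarith
  · refine ⟨8, by norm_num, fun n T v ε hε hε2 hT0 hTε hv0 hvε hT => ?_⟩
    have hpos : ∀ k, 0 < T k := fun k => (by positivity : 0 < ε ^ 2).trans_le (hTε k)
    refine (telescope Real.log 2 n T v (fun k hk => ?_) hT).trans ?_
    · rw [show -((1 + 1 : ℝ) / 2) = -1 by norm_num]
      exact mul_rpow_neg_one_le (hpos _) (hv0 _) ((hvε k hk).trans (hTε _))
    · rw [logFactor, if_neg (lt_irrefl _)]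
      have h1 := Real.log_le_log (hpos 0) hT0
      have h2 := Real.log_le_log (by positivity) (hTε n)
      rw [Real.log_pow] at h2
      have h3 := half_le_abs_log hε hε2
      have h4 := Real.log_two_lt_d9
      have h5 := neg_abs_le (Real.log ε)
      push_cast at h2
      linarith

/-! ### The Lindeberg argument -/

lemma le_two_mul_rate {ρ ε : ℝ} (hρ1 : ρ ≤ 1) (hε0 : 0 < ε) (hε : ε ≤ 1 / 2) :
    ε ≤ 2 * (ε ^ ρ * logFactor ρ ε) := by
  rcases lt_or_eq_of_le hρ1 with h | rfl
  · have h1 : ε ^ (1 : ℝ) ≤ ε ^ ρ := Real.rpow_le_rpow_of_exponent_ge hε0 (by linarith) hρ1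
    rw [Real.rpow_one] at h1
    rw [logFactor, if_pos h]
    linarith
  · rw [logFactor, if_neg (lt_irrefl _), Real.rpow_one]
    nlinarith [half_le_abs_log hε0 hε]

/-- The martingale differences `ξ 1, …, ξ n` have finite conditional moments of order `2 + ρ`,
controlled by their conditional variances `v i`; these are at most `ε ^ 2` and sum up to `1` within
`δ ^ 2`. All conditional expectations are Bochner ones, which is legitimate because the moments
are finite. -/
structure LyapunovArray {Ω : Type*} {m0 : MeasurableSpace Ω} (μ : Measure Ω)
    (ℱ : Filtration ℕ m0) (n : ℕ) (ξ v : ℕ → Ω → ℝ) (ρ ε δ : ℝ) : Prop where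
  measurable_v : ∀ i, Measurable[ℱ (i - 1)] (v i)
  v_nonneg : ∀ i ω, 0 ≤ v i ω
  measurable : ∀ i ∈ Finset.Icc 1 n, Measurable[ℱ i] (ξ i)
  integrable : ∀ i ∈ Finset.Icc 1 n, Integrable (ξ i) μ
  integrable_sq : ∀ i ∈ Finset.Icc 1 n, Integrable (fun ω => ξ i ω ^ 2) μ
  integrable_rpow : ∀ i ∈ Finset.Icc 1 n, Integrable (fun ω => |ξ i ω| ^ (2 + ρ)) μ
  condExp_eq_zero : ∀ i ∈ Finset.Icc 1 n, μ[ξ i | ℱ (i - 1)] =ᵐ[μ] 0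
  condExp_sq : ∀ i ∈ Finset.Icc 1 n, μ[fun ω => ξ i ω ^ 2 | ℱ (i - 1)] =ᵐ[μ] v i
  condExp_rpow : ∀ i ∈ Finset.Icc 1 n,
    μ[fun ω => |ξ i ω| ^ (2 + ρ) | ℱ (i - 1)] ≤ᵐ[μ] fun ω => ε ^ ρ * v i ω
  v_le : ∀ i ∈ Finset.Icc 1 n, ∀ᵐ ω ∂μ, v i ω ≤ ε ^ 2
  abs_sum_sub_one_le : ∀ᵐ ω ∂μ, |∑ i ∈ Finset.Icc 1 n, v i ω - 1| ≤ δ ^ 2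

/-- The variance still to be replaced after `k` steps, plus the smoothing variance `ε ^ 2`. The
total budget is `1 + δ ^ 2`, which almost surely dominates the whole conditional variance; the
maximum only matters on a null set. -/
noncomputable def remainingVariance {Ω : Type*} (v : ℕ → Ω → ℝ) (ε δ : ℝ) (k : ℕ) (ω : Ω) : ℝ :=
  ε ^ 2 + max 0 (1 + δ ^ 2 - ∑ i ∈ Finset.Icc 1 k, v i ω)

section remainingVariance

variable {Ω : Type*} {v : ℕ → Ω → ℝ} {ε δ : ℝ}

lemma le_remainingVariance (k : ℕ) (ω : Ω) : ε ^ 2 ≤ remainingVariance v ε δ k ω :=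
  le_add_of_nonneg_right (le_max_left _ _)

lemma remainingVariance_zero (ω : Ω) : remainingVariance v ε δ 0 ω = ε ^ 2 + (1 + δ ^ 2) := by
  simp only [remainingVariance, Finset.Icc_eq_empty_of_lt zero_lt_one, Finset.sum_empty, sub_zero]
  rw [max_eq_right (by positivity)]

lemma remainingVariance_le (hv : ∀ i ω, 0 ≤ v i ω) (k : ℕ) (ω : Ω) :
    remainingVariance v ε δ k ω ≤ ε ^ 2 + (1 + δ ^ 2) := by
  have : 0 ≤ ∑ i ∈ Finset.Icc 1 k, v i ω := Finset.sum_nonneg fun i _ => hv i ω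
  unfold remainingVariance
  gcongr
  exact max_le (by positivity) (by linarith)

lemma remainingVariance_eq_succ (hv : ∀ i ω, 0 ≤ v i ω) {n k : ℕ} (hk : k < n) {ω : Ω}
    (hω : ∑ i ∈ Finset.Icc 1 n, v i ω ≤ 1 + δ ^ 2) :
    remainingVariance v ε δ k ω = remainingVariance v ε δ (k + 1) ω + v (k + 1) ω := by
  have h1 : ∑ i ∈ Finset.Icc 1 (k + 1), v i ω ≤ ∑ i ∈ Finset.Icc 1 n, v i ω :=
    Finset.sum_le_sum_of_subset_of_nonneg (Finset.Icc_subset_Icc_right hk) fun i _ _ => hv i ω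
  have h2 : ∑ i ∈ Finset.Icc 1 (k + 1), v i ω = ∑ i ∈ Finset.Icc 1 k, v i ω + v (k + 1) ω :=
    Finset.sum_Icc_succ_top (by omega) _
  have h3 := hv (k + 1) ω
  unfold remainingVariance
  rw [max_eq_right (by linarith), max_eq_right (by linarith), h2]
  ring

lemma measurable_remainingVariance {m0 : MeasurableSpace Ω} {ℱ : Filtration ℕ m0}
    (hv : ∀ i, Measurable[ℱ (i - 1)] (v i)) (k : ℕ) :
    Measurable[ℱ (k - 1)] (remainingVariance v ε δ k) := by
  have h : Measurable[ℱ (k - 1)] (fun ω => ∑ i ∈ Finset.Icc 1 k, v i ω) :=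
    Finset.measurable_fun_sum _ fun i hi => (hv i).mono
      (ℱ.mono (Nat.sub_le_sub_right (Finset.mem_Icc.1 hi).2 1)) le_rfl
  exact (measurable_const.max (measurable_const.sub h)).const_add _

end remainingVariance

/-- The bound against a single `1`-Lipschitz test function. -/
lemma LyapunovArray.integral_sub_le {ρ : ℝ} (hρ0 : 0 < ρ) (hρ1 : ρ ≤ 1) :
    ∃ C : ℝ, 0 < C ∧
      ∀ (Ω : Type*) (m0 : MeasurableSpace Ω) (μ : Measure Ω) (_ : IsProbabilityMeasure μ)
        (ℱ : Filtration ℕ m0) (n : ℕ) (ξ v : ℕ → Ω → ℝ) (ε δ : ℝ),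
        0 < ε → ε ≤ 1 / 2 → 0 ≤ δ → δ ≤ 1 / 2 → LyapunovArray μ ℱ n ξ v ρ ε δ →
        ∀ h : ℝ → ℝ, LipschitzWith 1 h →
        ∫ ω, h (∑ i ∈ Finset.Icc 1 n, ξ i ω) ∂μ - ∫ x, h x ∂(gaussianReal 0 1)
          ≤ C * (ε ^ ρ * logFactor ρ ε + δ) := by
  obtain ⟨C, hC, H⟩ := integral_gaussSmooth_replace_le
  obtain ⟨L, hL, HL⟩ := sum_rpow_mul_le hρ0 hρ1
  refine ⟨C * L + 7, by positivity, ?_⟩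
  intro Ω m0 μ _ ℱ n ξ v ε δ hε0 hε hδ0 hδ A h hh
  set T := remainingVariance v ε δ with hT
  set S : ℕ → Ω → ℝ := fun k ω => ∑ i ∈ Finset.Icc 1 k, ξ i ω with hS
  have hvn := A.v_nonneg
  have hTle : ∀ k ω, T k ω ≤ 2 := fun k ω =>
    (remainingVariance_le hvn k ω).trans (by nlinarith)
  have hTge : ∀ k ω, ε ^ 2 ≤ T k ω := le_remainingVariance
  have hTm : ∀ k, Measurable[ℱ (k - 1)] (T k) := measurable_remainingVariance A.measurable_v
  have hSm : ∀ k ≤ n, Measurable[ℱ k] (S k) := fun k hk =>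
    Finset.measurable_fun_sum _ fun i hi => (A.measurable i (Finset.mem_Icc.2
      ⟨(Finset.mem_Icc.1 hi).1, (Finset.mem_Icc.1 hi).2.trans hk⟩)).mono
      (ℱ.mono (Finset.mem_Icc.1 hi).2) le_rfl
  have hSi : ∀ k ≤ n, Integrable (S k) μ := fun k hk =>
    integrable_finsetSum _ fun i hi => A.integrable i (Finset.mem_Icc.2
      ⟨(Finset.mem_Icc.1 hi).1, (Finset.mem_Icc.1 hi).2.trans hk⟩)
  have hmem : ∀ k < n, k + 1 ∈ Finset.Icc 1 n := fun k hk => Finset.mem_Icc.2 (by omega)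
  have hTsucc : ∀ᵐ ω ∂μ, ∀ k < n, T k ω = T (k + 1) ω + v (k + 1) ω := by
    filter_upwards [A.abs_sum_sub_one_le] with ω hω k hk
    exact remainingVariance_eq_succ hvn hk (by linarith [(abs_le.1 hω).2])
  have hSsucc : ∀ k ω, S (k + 1) ω = S k ω + ξ (k + 1) ω := fun k ω =>
    Finset.sum_Icc_succ_top (by omega) _
  have hvle : ∀ᵐ ω ∂μ, ∀ k < n, v (k + 1) ω ≤ ε ^ 2 :=
    ae_all_iff.2 fun k => Filter.eventually_imp_distrib_left.2 fun hk => A.v_le _ (hmem k hk)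
  set w : ℕ → Ω → ℝ := fun k ω => T k ω ^ (-((1 + ρ) / 2)) * v k ω with hw
  have hstep : ∀ k < n, ∫ ω, gaussSmooth h (T (k + 1) ω) (S (k + 1) ω) ∂μ
      - ∫ ω, gaussSmooth h (T k ω) (S k ω) ∂μ ≤ C * ε ^ ρ * ∫ ω, w (k + 1) ω ∂μ := by
    intro k hk
    have hi := hmem k hk
    have key := H h hh ρ hρ0 hρ1 Ω (ℱ k) m0 μ inferInstance (ℱ.le k) (S k) (T (k + 1))
      (v (k + 1)) (ξ (k + 1)) ε (ε ^ 2) 2 hε0 (by positivity) (hSm k hk.le) (hTm (k + 1))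
      (A.measurable_v (k + 1)) ((A.measurable _ hi).mono (ℱ.le _) le_rfl) (hSi k hk.le)
      (hTge _) (hTle _) (hvn _) (A.v_le _ hi) (A.integrable _ hi) (A.integrable_sq _ hi)
      (A.integrable_rpow _ hi) (A.condExp_eq_zero _ hi) (A.condExp_sq _ hi) (A.condExp_rpow _ hi)
    have e : ∫ ω, gaussSmooth h (T (k + 1) ω + v (k + 1) ω) (S k ω) ∂μ
        = ∫ ω, gaussSmooth h (T k ω) (S k ω) ∂μ := by
      refine integral_congr_ae ?_
      filter_upwards [hTsucc] with ω hω
      rw [hω k hk]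
    rw [e] at key
    simpa only [hSsucc] using key
  have hwi : ∀ k < n, Integrable (w (k + 1)) μ := fun k hk => by
    refine integrable_mul_of_abs_le (c := (ε ^ 2) ^ (-((1 + ρ) / 2)))
      (((hTm (k + 1)).mono (ℱ.le _) le_rfl).pow_const _) (fun ω => ?_)
      (integrable_condExp.congr (A.condExp_sq _ (hmem k hk)))
    have h0 : 0 < ε ^ 2 := by positivity
    rw [abs_of_nonneg (Real.rpow_nonneg (h0.le.trans (hTge _ _)) _)]
    exact Real.rpow_le_rpow_of_nonpos h0 (hTge _ _) (by linarith)
  have hsum : ∑ k ∈ Finset.range n, ∫ ω, w (k + 1) ω ∂μ ≤ L * logFactor ρ ε := by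
    rw [← integral_finsetSum _ fun k hk => hwi k (Finset.mem_range.1 hk)]
    have : ∫ _ : Ω, L * logFactor ρ ε ∂μ = L * logFactor ρ ε := by simp
    rw [← this]
    refine integral_mono_ae
      (integrable_finsetSum _ fun k hk => hwi k (Finset.mem_range.1 hk)) (integrable_const _) ?_
    filter_upwards [hTsucc, hvle] with ω h1 h2
    exact HL n (fun k => T k ω) (fun k => v k ω) ε hε0 hε (hTle 0 ω) (fun k => hTge k ω)
      (fun k => hvn k ω) h2 h1
  have htel : ∫ ω, gaussSmooth h (T n ω) (S n ω) ∂μ - ∫ ω, gaussSmooth h (T 0 ω) (S 0 ω) ∂μ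
      ≤ C * ε ^ ρ * (L * logFactor ρ ε) := by
    rw [← Finset.sum_range_sub (fun k => ∫ ω, gaussSmooth h (T k ω) (S k ω) ∂μ)]
    refine (Finset.sum_le_sum fun k hk => hstep k (Finset.mem_range.1 hk)).trans ?_
    rw [← Finset.mul_sum]
    gcongr
  have hstart : ∫ ω, gaussSmooth h (T 0 ω) (S 0 ω) ∂μ
      ≤ ∫ x, h x ∂(gaussianReal 0 1) + (ε + δ) := by
    have e0 : ∀ ω, gaussSmooth h (T 0 ω) (S 0 ω) = gaussSmooth h (ε ^ 2 + (1 + δ ^ 2)) 0 :=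
      fun ω => by
        rw [hT, remainingVariance_zero]
        simp [hS]
    have e1 : gaussSmooth h 1 0 = ∫ x, h x ∂(gaussianReal 0 1) := by simp [gaussSmooth]
    simp_rw [e0]
    simp only [integral_const, probReal_univ, smul_eq_mul, one_mul]
    have h1 := (abs_le.1 (abs_gaussSmooth_sub_le hh (ε ^ 2 + (1 + δ ^ 2)) 1 0 0)).2
    have h2 : 1 ≤ √(ε ^ 2 + (1 + δ ^ 2)) := Real.one_le_sqrt.2 (by nlinarith)
    have h3 : √(ε ^ 2 + (1 + δ ^ 2)) ≤ 1 + (ε + δ) :=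
      Real.sqrt_le_iff.2 ⟨by positivity, by nlinarith [mul_nonneg hε0.le hδ0]⟩
    rw [Real.sqrt_one, e1, sub_self, abs_zero, abs_of_nonneg (by linarith)] at h1
    linarith
  have hTm0 := (hTm n).mono (ℱ.le _) le_rfl
  have hSm0 := (hSm n le_rfl).mono (ℱ.le _) le_rfl
  have hend : ∫ ω, h (S n ω) ∂μ ≤ ∫ ω, gaussSmooth h (T n ω) (S n ω) ∂μ + (ε + 2 * δ) := by
    have i1 : Integrable (fun ω => gaussSmooth h (T n ω) (S n ω)) μ :=
      integrable_gaussSmooth hh (hSi n le_rfl) hSm0 hTm0 (Filter.Eventually.of_forall (hTle n))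
    have i2 : Integrable (fun ω => h (S n ω)) μ := by
      simpa only [gaussSmooth_zero] using integrable_gaussSmooth hh (hSi n le_rfl) hSm0
        (measurable_const (a := (0 : ℝ))) (M := 0) (Filter.Eventually.of_forall fun _ => le_rfl)
    have : ∫ ω, (gaussSmooth h (T n ω) (S n ω) + (ε + 2 * δ)) ∂μ
        = ∫ ω, gaussSmooth h (T n ω) (S n ω) ∂μ + (ε + 2 * δ) := by
      rw [integral_add i1 (integrable_const _)]; simp
    rw [← this]
    refine integral_mono_ae i2 (i1.fun_add (integrable_const _)) ?_
    filter_upwards [A.abs_sum_sub_one_le] with ω hω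
    have h1 := (abs_le.1 (abs_gaussSmooth_sub_le hh (T n ω) 0 (S n ω) (S n ω))).1
    have h2 : T n ω ≤ ε ^ 2 + 2 * δ ^ 2 := by
      rw [hT, remainingVariance]
      gcongr
      exact max_le (by positivity) (by linarith [(abs_le.1 hω).1])
    have h3 : √(T n ω) ≤ ε + 2 * δ :=
      Real.sqrt_le_iff.2 ⟨by positivity, by nlinarith [mul_nonneg hε0.le hδ0]⟩
    rw [gaussSmooth_zero, Real.sqrt_zero, sub_self, abs_zero, sub_zero,
      abs_of_nonneg (Real.sqrt_nonneg _)] at h1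
    linarith
  have hrate := le_two_mul_rate hρ1 hε0 hε
  have : C * ε ^ ρ * (L * logFactor ρ ε) = C * L * (ε ^ ρ * logFactor ρ ε) := by ring
  have hp : 0 ≤ C * L * δ := by positivity
  simp only [hS] at hend
  nlinarith

/-! ### Conditional moments -/

lemma condLExp_le_of_le_linear {Ω : Type*} {m m0 : MeasurableSpace Ω} {μ : Measure Ω}
    {X Y Z : Ω → ℝ≥0∞} {a b : ℝ≥0∞} (hY : Measurable Y) (hZ : Measurable Z)
    (h : ∀ ω, X ω ≤ a * Y ω + b * Z ω) :
    ∀ᵐ ω ∂μ, μ⁻[X | m] ω ≤ a * μ⁻[Y | m] ω + b * μ⁻[Z | m] ω := by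
  have h1 : μ⁻[X | m] ≤ᵐ[μ] μ⁻[a • Y + b • Z | m] :=
    condLExp_mono (Filter.Eventually.of_forall h)
  have h2 := condLExp_add_left (P := μ) (mΩ := m) (b • Z) (hY.const_smul a).aemeasurable
  have h3 := condLExp_smul (P := μ) (mΩ := m) Y hY.aemeasurable a
  have h4 := condLExp_smul (P := μ) (mΩ := m) Z hZ.aemeasurable b
  filter_upwards [h1, h2, h3, h4] with ω e1 e2 e3 e4
  rw [e2, Pi.add_apply, e3, e4] at e1
  exact e1

/-- Weighted arithmetic-geometric mean inequality, by Bernoulli's inequality. -/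
lemma le_mul_add_mul_rpow {q x e : ℝ} (hq : 1 ≤ q) (hx : 0 ≤ x) (he : 0 < e) :
    x ≤ e * (1 - 1 / q) + 1 / q * e ^ (1 - q) * x ^ q := by
  have hb := one_add_mul_self_le_rpow_one_add (s := x / e - 1) (p := q)
    (by have := div_nonneg hx he.le; linarith) hq
  rw [add_sub_cancel, Real.div_rpow hx he.le] at hb
  have hq0 : 0 < q := by linarith
  have he' := Real.rpow_pos_of_pos he q
  have h1 : e ^ (1 - q) = e / e ^ q := by rw [Real.rpow_sub he, Real.rpow_one]
  have h2 : e * (1 - 1 / q) + 1 / q * (e / e ^ q) * x ^ q - x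
      = e / q * (x ^ q / e ^ q - (1 + q * (x / e - 1))) := by field_simp; ring
  have h3 : 0 ≤ e / q * (x ^ q / e ^ q - (1 + q * (x / e - 1))) :=
    mul_nonneg (by positivity) (by linarith)
  rw [h1]; linarith

lemma measurable_ofReal_abs_rpow {Ω : Type*} {m0 : MeasurableSpace Ω} {Y : Ω → ℝ}
    (hY : Measurable Y) (r : ℝ) : Measurable (fun ω => ENNReal.ofReal (|Y ω| ^ r)) :=
  ((measurable_abs.comp hY).pow_const r).ennreal_ofReal

section Lyapunov

variable {Ω : Type*} {m m0 : MeasurableSpace Ω} {μ : Measure Ω} {Y : Ω → ℝ} {ρ ε : ℝ}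

/-- For `ρ ≥ 1` the Lyapunov condition of exponent `ρ` implies that of exponent `1`. -/
lemma condMoment_three_le (hY : Measurable Y) (hρ : 1 ≤ ρ) (hε : 0 < ε)
    (h : ∀ᵐ ω ∂μ, condMoment μ m (2 + ρ) Y ω ≤ ENNReal.ofReal (ε ^ ρ) * condMoment μ m 2 Y ω) :
    ∀ᵐ ω ∂μ, condMoment μ m (2 + 1) Y ω ≤ ENNReal.ofReal (ε ^ (1 : ℝ)) * condMoment μ m 2 Y ω := by
  have ha : 0 ≤ ε * (1 - 1 / ρ) := mul_nonneg hε.le (by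
    rw [sub_nonneg, div_le_one (by linarith)]; exact hρ)
  have hb : 0 ≤ 1 / ρ * ε ^ (1 - ρ) := by positivity
  have hpt : ∀ ω, ENNReal.ofReal (|Y ω| ^ (2 + 1 : ℝ))
      ≤ ENNReal.ofReal (ε * (1 - 1 / ρ)) * ENNReal.ofReal (|Y ω| ^ (2 : ℝ))
        + ENNReal.ofReal (1 / ρ * ε ^ (1 - ρ)) * ENNReal.ofReal (|Y ω| ^ (2 + ρ)) := fun ω => by
    rw [← ENNReal.ofReal_mul ha, ← ENNReal.ofReal_mul hb,
      ← ENNReal.ofReal_add (by positivity) (by positivity)]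
    refine ENNReal.ofReal_le_ofReal ?_
    have h1 := le_mul_add_mul_rpow hρ (abs_nonneg (Y ω)) hε
    rw [Real.rpow_add_of_nonneg (abs_nonneg _) (by norm_num) (by norm_num), Real.rpow_one,
      Real.rpow_add_of_nonneg (abs_nonneg _) (by norm_num) (by linarith)]
    have h2 : 0 ≤ |Y ω| ^ (2 : ℝ) := by positivity
    nlinarith [mul_le_mul_of_nonneg_left h1 h2]
  filter_upwards [h, condLExp_le_of_le_linear (μ := μ) (m := m) (measurable_ofReal_abs_rpow hY 2)
    (measurable_ofReal_abs_rpow hY (2 + ρ)) hpt] with ω h1 h2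
  refine h2.trans ?_
  calc _ ≤ ENNReal.ofReal (ε * (1 - 1 / ρ)) * condMoment μ m 2 Y ω
        + ENNReal.ofReal (1 / ρ * ε ^ (1 - ρ)) *
          (ENNReal.ofReal (ε ^ ρ) * condMoment μ m 2 Y ω) :=
        add_le_add le_rfl (mul_le_mul' le_rfl h1)
    _ = ENNReal.ofReal (ε ^ (1 : ℝ)) * condMoment μ m 2 Y ω := by
      rw [← mul_assoc, ← add_mul, ← ENNReal.ofReal_mul hb,
        ← ENNReal.ofReal_add ha (by positivity)]
      congr 2
      have : ε ^ (1 - ρ) * ε ^ ρ = ε := by rw [← Real.rpow_add hε]; simp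
      rw [mul_assoc, this, Real.rpow_one]; ring

/-- The Lyapunov condition forces a finite conditional variance to be at most `ε ^ 2`. -/
lemma condMoment_two_le [IsProbabilityMeasure μ] (hm : m ≤ m0) (hY : Measurable Y) (hρ : 0 < ρ)
    (hε : 0 < ε) (hfin : ∀ᵐ ω ∂μ, condMoment μ m 2 Y ω ≠ ∞)
    (h : ∀ᵐ ω ∂μ, condMoment μ m (2 + ρ) Y ω ≤ ENNReal.ofReal (ε ^ ρ) * condMoment μ m 2 Y ω) :
    ∀ᵐ ω ∂μ, condMoment μ m 2 Y ω ≤ ENNReal.ofReal (ε ^ 2) := by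
  set q := (2 + ρ) / 2 with hq
  have hq1 : 1 < q := by rw [hq]; linarith
  have hq2 : 1 / q < 1 := (div_lt_one (by linarith)).2 hq1
  have ha : 0 ≤ ε ^ 2 * (1 - 1 / q) := mul_nonneg (by positivity) (by linarith)
  have hb : 0 ≤ 1 / q * (ε ^ 2) ^ (1 - q) := by positivity
  have hpt : ∀ ω, ENNReal.ofReal (|Y ω| ^ (2 : ℝ))
      ≤ ENNReal.ofReal (ε ^ 2 * (1 - 1 / q)) * (fun _ => 1 : Ω → ℝ≥0∞) ω
        + ENNReal.ofReal (1 / q * (ε ^ 2) ^ (1 - q)) * ENNReal.ofReal (|Y ω| ^ (2 + ρ)) :=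
    fun ω => by
    rw [mul_one, ← ENNReal.ofReal_mul hb, ← ENNReal.ofReal_add ha (by positivity)]
    refine ENNReal.ofReal_le_ofReal ?_
    have h1 := le_mul_add_mul_rpow hq1.le (by positivity : 0 ≤ |Y ω| ^ (2 : ℝ))
      (by positivity : 0 < ε ^ 2)
    rwa [← Real.rpow_mul (abs_nonneg _), show 2 * q = 2 + ρ by rw [hq]; ring] at h1
  filter_upwards [h, hfin, condLExp_le_of_le_linear (μ := μ) (m := m) measurable_const
    (measurable_ofReal_abs_rpow hY (2 + ρ)) hpt] with ω h1 h2 h3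
  rw [condLExp_const hm, mul_one] at h3
  have h4 : condMoment μ m 2 Y ω ≤ ENNReal.ofReal (ε ^ 2 * (1 - 1 / q))
      + ENNReal.ofReal (1 / q) * condMoment μ m 2 Y ω := by
    refine h3.trans (add_le_add_right ?_ _)
    calc _ ≤ ENNReal.ofReal (1 / q * (ε ^ 2) ^ (1 - q)) *
          (ENNReal.ofReal (ε ^ ρ) * condMoment μ m 2 Y ω) := by gcongr; exact h1
      _ = _ := by
        rw [← mul_assoc, ← ENNReal.ofReal_mul hb]
        congr 2
        have : (ε ^ 2) ^ (1 - q) * ε ^ ρ = 1 := by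
          have e : ((2 : ℕ) : ℝ) * (1 - q) + ρ = 0 := by rw [hq]; push_cast; ring
          rw [← Real.rpow_natCast, ← Real.rpow_mul hε.le, ← Real.rpow_add hε, e, Real.rpow_zero]
        rw [mul_assoc, this, mul_one]
  obtain ⟨c, hc⟩ : ∃ c : ℝ, c = (condMoment μ m 2 Y ω).toReal := ⟨_, rfl⟩
  have hc0 : 0 ≤ c := hc ▸ ENNReal.toReal_nonneg
  have hce : condMoment μ m 2 Y ω = ENNReal.ofReal c := by rw [hc, ENNReal.ofReal_toReal h2]
  rw [hce, ← ENNReal.ofReal_mul (by positivity), ← ENNReal.ofReal_add ha (by positivity),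
    ENNReal.ofReal_le_ofReal_iff (by positivity)] at h4
  rw [hce]
  refine ENNReal.ofReal_le_ofReal ?_
  nlinarith

lemma toReal_condMoment_ae_eq (hY : Measurable Y) {r : ℝ}
    (hfin : ∫⁻ ω, ENNReal.ofReal (|Y ω| ^ r) ∂μ ≠ ∞) :
    (fun ω => (condMoment μ m r Y ω).toReal) =ᵐ[μ] μ[fun ω => |Y ω| ^ r | m] := by
  have h := toReal_condLExp m (measurable_ofReal_abs_rpow hY r).aemeasurable hfin
  have e : (fun ω => (ENNReal.ofReal (|Y ω| ^ r)).toReal) = fun ω => |Y ω| ^ r :=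
    funext fun ω => ENNReal.toReal_ofReal (by positivity)
  rwa [e] at h

lemma integrable_abs_rpow (hY : Measurable Y) {r : ℝ}
    (hfin : ∫⁻ ω, ENNReal.ofReal (|Y ω| ^ r) ∂μ ≠ ∞) :
    Integrable (fun ω => |Y ω| ^ r) μ := by
  refine ⟨((measurable_abs.comp hY).pow_const r).aestronglyMeasurable, ?_⟩
  rw [hasFiniteIntegral_iff_ofReal (Filter.Eventually.of_forall fun ω => by positivity)]
  exact hfin.lt_top

end Lyapunov

/-- Passage from the `[0, ∞]`-valued hypotheses to real-valued conditional moments. -/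
lemma lyapunovArray_of_condLyapunov {Ω : Type*} {m0 : MeasurableSpace Ω} {μ : Measure Ω}
    [IsProbabilityMeasure μ] {ℱ : Filtration ℕ m0} {n : ℕ} {ξ : ℕ → Ω → ℝ} {ρ ε δ : ℝ}
    (hρ : 0 < ρ) (hε : 0 < ε) (hξ : IsMartingaleDifference μ ℱ ξ n)
    (hL : CondLyapunov μ ℱ ξ n ρ ε)
    (hV : essDist μ (condVariance μ ℱ ξ n) (fun _ => 1) ≤ ENNReal.ofReal (δ ^ 2)) :
    LyapunovArray μ ℱ n ξ (fun i ω => (condMoment μ (ℱ (i - 1)) 2 (ξ i) ω).toReal) ρ ε δ := by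
  have hVae : ∀ᵐ ω ∂μ, (condVariance μ ℱ ξ n ω - 1) + (1 - condVariance μ ℱ ξ n ω)
      ≤ ENNReal.ofReal (δ ^ 2) := by
    filter_upwards [ENNReal.ae_le_essSup
      (fun ω => (condVariance μ ℱ ξ n ω - 1) + (1 - condVariance μ ℱ ξ n ω))] with ω hω
    exact hω.trans hV
  have hVle : ∀ᵐ ω ∂μ, condVariance μ ℱ ξ n ω ≤ ENNReal.ofReal (δ ^ 2) + 1 := by
    filter_upwards [hVae] with ω hω
    exact tsub_le_iff_right.1 (le_self_add.trans hω)
  have hM : ∀ i ∈ Finset.Icc 1 n, ∀ᵐ ω ∂μ,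
      condMoment μ (ℱ (i - 1)) 2 (ξ i) ω ≤ ENNReal.ofReal (δ ^ 2) + 1 := fun i hi => by
    filter_upwards [hVle] with ω hω
    exact (Finset.single_le_sum (f := fun i => condMoment μ (ℱ (i - 1)) 2 (ξ i) ω)
      (fun _ _ => zero_le) hi).trans hω
  have hMfin : ∀ i ∈ Finset.Icc 1 n, ∀ᵐ ω ∂μ, condMoment μ (ℱ (i - 1)) 2 (ξ i) ω ≠ ∞ :=
    fun i hi => (hM i hi).mono fun ω hω => ne_top_of_le_ne_top (by simp) hω
  have hmeas : ∀ i ∈ Finset.Icc 1 n, Measurable (ξ i) :=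
    fun i hi => (hξ.measurable i hi).mono (ℱ.le i) le_rfl
  have hfin2 : ∀ i ∈ Finset.Icc 1 n, ∫⁻ ω, ENNReal.ofReal (|ξ i ω| ^ (2 : ℝ)) ∂μ ≠ ∞ :=
    fun i hi => by
    rw [← lintegral_condLExp (ℱ.le (i - 1))]
    refine ne_top_of_le_ne_top ?_ (lintegral_mono_ae (hM i hi))
    simp
  have hfinp : ∀ i ∈ Finset.Icc 1 n, ∫⁻ ω, ENNReal.ofReal (|ξ i ω| ^ (2 + ρ)) ∂μ ≠ ∞ :=
    fun i hi => by
    rw [← lintegral_condLExp (ℱ.le (i - 1))]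
    refine ne_top_of_le_ne_top ?_ (lintegral_mono_ae (hL i hi))
    have hm : Measurable (condMoment μ (ℱ (i - 1)) 2 (ξ i)) := measurable_condLExp' _ _ _
    rw [lintegral_const_mul _ hm]
    refine ENNReal.mul_ne_top ENNReal.ofReal_ne_top ?_
    unfold condMoment
    rw [lintegral_condLExp (ℱ.le (i - 1))]
    exact hfin2 i hi
  have hsq : ∀ i, (fun ω => |ξ i ω| ^ (2 : ℝ)) = fun ω => ξ i ω ^ 2 := fun i => funext fun ω => by
    rw [Real.rpow_two, sq_abs]
  refine ⟨fun i => (measurable_condLExp _ _ _).ennreal_toReal, fun i ω => ENNReal.toReal_nonneg,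
    hξ.measurable, hξ.integrable, fun i hi => ?_, fun i hi => ?_, hξ.condExp_eq_zero,
    fun i hi => ?_, fun i hi => ?_, fun i hi => ?_, ?_⟩
  · rw [← hsq]; exact integrable_abs_rpow (hmeas i hi) (hfin2 i hi)
  · exact integrable_abs_rpow (hmeas i hi) (hfinp i hi)
  · rw [← hsq]; exact (toReal_condMoment_ae_eq (hmeas i hi) (hfin2 i hi)).symm
  · filter_upwards [toReal_condMoment_ae_eq (m := ℱ (i - 1)) (hmeas i hi) (hfinp i hi), hL i hi,
      hMfin i hi] with ω h1 h2 h3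
    rw [← h1]
    refine (ENNReal.toReal_mono (ENNReal.mul_ne_top ENNReal.ofReal_ne_top h3) h2).trans ?_
    rw [ENNReal.toReal_mul, ENNReal.toReal_ofReal (by positivity)]
  · filter_upwards [condMoment_two_le (ℱ.le (i - 1)) (hmeas i hi) hρ hε (hMfin i hi) (hL i hi)]
      with ω h1
    exact ENNReal.toReal_le_of_le_ofReal (by positivity) h1
  · have hMfin' : ∀ᵐ ω ∂μ, ∀ i ∈ Finset.Icc 1 n, condMoment μ (ℱ (i - 1)) 2 (ξ i) ω ≠ ∞ :=
      (Filter.eventually_all_finset _).2 hMfin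
    filter_upwards [hVae, hMfin'] with ω h1 h2
    rw [← ENNReal.toReal_sum h2]
    change |(condVariance μ ℱ ξ n ω).toReal - 1| ≤ δ ^ 2
    have h3 : condVariance μ ℱ ξ n ω ≠ ∞ := ENNReal.sum_ne_top.2 h2
    have h4 : condVariance μ ℱ ξ n ω ≤ ENNReal.ofReal (δ ^ 2) + 1 :=
      tsub_le_iff_right.1 (le_self_add.trans h1)
    have h5 : 1 ≤ ENNReal.ofReal (δ ^ 2) + condVariance μ ℱ ξ n ω :=
      tsub_le_iff_right.1 (le_add_self.trans h1)
    have h6 := ENNReal.toReal_mono (by simp) h4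
    have h7 := ENNReal.toReal_mono (by simp [h3]) h5
    rw [ENNReal.toReal_add (by simp) (by simp), ENNReal.toReal_ofReal (by positivity),
      ENNReal.toReal_one] at h6
    rw [ENNReal.toReal_add (by simp) h3, ENNReal.toReal_ofReal (by positivity),
      ENNReal.toReal_one] at h7
    rw [abs_le]; constructor <;> linarith

lemma epsHat_eq {ρ ε : ℝ} : epsHat ρ ε = ε ^ min ρ 1 * logFactor (min ρ 1) ε := by
  rcases lt_or_ge ρ 1 with h | h
  · simp [epsHat, logFactor, h, min_eq_left h.le]
  · simp [epsHat, logFactor, h.not_gt, min_eq_right h]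

end MartingaleCLT

theorem lemma2p3 (ρ : ℝ) (hρ : 0 < ρ) :
    ∃ C : ℝ, 0 < C ∧
      ∀ (Ω : Type*) (m0 : MeasurableSpace Ω) (μ : Measure Ω) (_ : IsProbabilityMeasure μ)
        (ℱ : Filtration ℕ m0) (n : ℕ) (ξ : ℕ → Ω → ℝ) (ε δ : ℝ),
        MartingaleCLT.IsMartingaleDifference μ ℱ ξ n →
        ε ∈ Set.Ioc (0 : ℝ) (1 / 2) →
        MartingaleCLT.CondLyapunov μ ℱ ξ n ρ ε →
        δ ∈ Set.Icc (0 : ℝ) (1 / 2) →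
        MartingaleCLT.essDist μ (MartingaleCLT.condVariance μ ℱ ξ n) (fun _ => 1)
          ≤ ENNReal.ofReal (δ ^ 2) →
        MartingaleCLT.wassersteinNormal μ (fun ω => ∑ i ∈ Finset.Icc 1 n, ξ i ω)
          ≤ ENNReal.ofReal (C * (MartingaleCLT.epsHat ρ ε + δ)) := by
  have hρ' : 0 < min ρ 1 := lt_min hρ one_pos
  obtain ⟨C, hC, H⟩ := MartingaleCLT.LyapunovArray.integral_sub_le hρ' (min_le_right ρ 1)
  refine ⟨C, hC, ?_⟩
  intro Ω m0 μ _ ℱ n ξ ε δ hξ hε hL hδ hV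
  have hmeas : ∀ i ∈ Finset.Icc 1 n, Measurable (ξ i) :=
    fun i hi => (hξ.measurable i hi).mono (ℱ.le i) le_rfl
  have hL' : MartingaleCLT.CondLyapunov μ ℱ ξ n (min ρ 1) ε := by
    rcases le_total ρ 1 with h | h
    · rwa [min_eq_left h]
    · rw [min_eq_right h]
      exact fun i hi => MartingaleCLT.condMoment_three_le (hmeas i hi) h hε.1 (hL i hi)
  have A := MartingaleCLT.lyapunovArray_of_condLyapunov hρ' hε.1 hξ hL' hV
  have hSm : Measurable (fun ω => ∑ i ∈ Finset.Icc 1 n, ξ i ω) :=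
    Finset.measurable_fun_sum _ hmeas
  have hSi : Integrable (fun ω => ∑ i ∈ Finset.Icc 1 n, ξ i ω) μ :=
    integrable_finsetSum _ hξ.integrable
  have : IsProbabilityMeasure (μ.map (fun ω => ∑ i ∈ Finset.Icc 1 n, ξ i ω)) :=
    Measure.isProbabilityMeasure_map hSm.aemeasurable
  refine MartingaleCLT.lintegral_cdf_sub_le _ _
    ((integrable_map_measure (by fun_prop) hSm.aemeasurable).2 hSi)
    MartingaleCLT.integrable_id_gaussian _ fun h hh => ?_
  rw [integral_map hSm.aemeasurable hh.continuous.aestronglyMeasurable, MartingaleCLT.epsHat_eq]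
  exact H Ω m0 μ inferInstance ℱ n ξ _ ε δ hε.1 hε.2 hδ.1 hδ.2 A h hh
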